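/- Let $(M,g)$ be a two-dimensional smooth Riemannian manifold (without boundary) of constant sectional curvature $K\in\mathbb R$, with Levi-Civita connection $\nabla$, extended complex-bilinearly to the complexified tangent bundle $E=\mathbb C\otimes_{\mathbb R}TM$, and let $R(Z,W)V=\nabla_Z\nabla_WV-\nabla_W\nabla_ZV-\nabla_{[Z,W]}V$. Let $U\subseteq M$ be open and $f:U\to\mathbb C$ smooth. For smooth sections $Z_1,\dots,Z_n$ of $E$ over $U$ define $\nabla^0f=f$ and $$(\nabla^{n}f)(Z_1,\dots,Z_n)=Z_1\big((\nabla^{n-1}f)(Z_2,\dots,Z_n)\big)-\sum_{j=2}^n(\nabla^{n-1}f)(Z_2,\dots,\nabla_{Z_1}Z_j,\dots,Z_n).$$ Then for every $n\ge 3$ and all smooth sections $Z_1,\dots,Z_n$ of $E$ over $U$, on $U$ we have $$(\nabla^nf)(Z_1,\dots,Z_{n-1},Z_n)-(\nabla^nf)(Z_1,\dots,Z_n,Z_{n-1})=0,$$ and for every $i=1,\dots,n-2$, $$(\nabla^nf)(Z_1,\dots,Z_i,Z_{i+1},\dots,Z_n)-(\nabla^nf)(Z_1,\dots,Z_{i+1},Z_i,\dots,Z_n)=\sum_{j=i+2}^n(\nabla^{n-2}f)(Z_1,\dots,Z_{i-1},Z_{i+2},\dots,Z_{j-1},-R(Z_i,Z_{i+1})Z_j,Z_{j+1},\dots,Z_n).$$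 -/

import Mathlib

open Bundle
open scoped Manifold ContDiff TensorProduct

noncomputable section

namespace CovHess

section RealFields

variable {E : Type*} [NormedAddCommGroup E] [NormedSpace ℝ E]
  {M : Type*} [TopologicalSpace M] [ChartedSpace E M] [IsManifold 𝓘(ℝ, E) ∞ M]

variable (E M) in
/-- (Not necessarily smooth) vector fields on `M`, i.e. sections of `TM`. -/
abbrev VField : Type _ := (x : M) → TangentSpace 𝓘(ℝ, E) x

/-- The vector field `X` is smooth on the open set `U`. -/
def SmoothFieldOn (X : VField E M) (U : Set M) : Prop :=
  ContMDiffOn 𝓘(ℝ, E) (𝓘(ℝ, E).prod 𝓘(ℝ, E)) ∞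
    (fun x => (⟨x, X x⟩ : TangentBundle 𝓘(ℝ, E) M)) U

variable (E M) in
/-- Connections on the tangent bundle; `cov Y x (X x)` is `(∇_X Y)(x)`. -/
abbrev Connection : Type _ :=
  CovariantDerivative 𝓘(ℝ, E) E (fun x : M => TangentSpace 𝓘(ℝ, E) x)

/-- The curvature `R(X,Y)Z = ∇_X ∇_Y Z - ∇_Y ∇_X Z - ∇_{[X,Y]} Z`. -/
def curvature (cov : Connection E M) (X Y Z : VField E M) : VField E M := fun x =>
  cov (fun y => cov Z y (Y y)) x (X x) - cov (fun y => cov Z y (X y)) x (Y x)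
    - cov Z x (VectorField.mlieBracket 𝓘(ℝ, E) X Y x)

end RealFields

section Riemannian

variable {E : Type*} [NormedAddCommGroup E] [NormedSpace ℝ E] [FiniteDimensional ℝ E]
  {M : Type*} [TopologicalSpace M] [ChartedSpace E M] [IsManifold 𝓘(ℝ, E) ∞ M]

variable (E M) in
/-- Smooth Riemannian metrics on `M`; `g.inner x` is the inner product on the tangent space
at `x`. -/
abbrev Metric : Type _ :=
  ContMDiffRiemannianMetric 𝓘(ℝ, E) ∞ E (fun x : M => TangentSpace 𝓘(ℝ, E) x)

/-- `cov` is the Levi-Civita connection of the metric `g`: the (unique) smooth connection on `TM`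
which is torsion-free, `∇_X Y - ∇_Y X = [X, Y]`, and compatible with the metric,
`X⟨Y, Z⟩ = ⟨∇_X Y, Z⟩ + ⟨Y, ∇_X Z⟩`. -/
structure IsLeviCivita (g : Metric E M) (cov : Connection E M) : Prop where
  smooth : cov.ContMDiffCovariantDerivative ∞
  torsion_free : cov.torsion = 0
  metric : ∀ (Y Z : VField E M) (x : M),
    MDifferentiableAt 𝓘(ℝ, E) (𝓘(ℝ, E).prod 𝓘(ℝ, E))
      (fun y => (⟨y, Y y⟩ : TangentBundle 𝓘(ℝ, E) M)) x →
    MDifferentiableAt 𝓘(ℝ, E) (𝓘(ℝ, E).prod 𝓘(ℝ, E))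
      (fun y => (⟨y, Z y⟩ : TangentBundle 𝓘(ℝ, E) M)) x →
    ∀ v : TangentSpace 𝓘(ℝ, E) x,
      mvfderiv 𝓘(ℝ, E) (fun y => g.inner y (Y y) (Z y)) x v
        = g.inner x (cov Y x v) (Z x) + g.inner x (Y x) (cov Z x v)

/-- The sectional curvature `⟨R(X,Y)Y, X⟩ / (⟨X,X⟩⟨Y,Y⟩ - ⟨X,Y⟩²)` at `x` of the plane spanned by
`X x` and `Y x`. -/
def sectionalCurvature (g : Metric E M) (cov : Connection E M) (X Y : VField E M) (x : M) : ℝ :=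
  g.inner x (curvature cov X Y Y x) (X x) /
    (g.inner x (X x) (X x) * g.inner x (Y x) (Y x) - g.inner x (X x) (Y x) ^ 2)

/-- All the sectional curvatures are equal to `K`. -/
def HasConstantCurvature (g : Metric E M) (cov : Connection E M) (K : ℝ) : Prop :=
  ∀ U : Set M, IsOpen U → ∀ X Y : VField E M, SmoothFieldOn X U → SmoothFieldOn Y U →
    ∀ x ∈ U, LinearIndependent ℝ ![X x, Y x] → sectionalCurvature g cov X Y x = K

end Riemannian

section ComplexFields

variable {E : Type*} [NormedAddCommGroup E] [NormedSpace ℝ E]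
  {M : Type*} [TopologicalSpace M] [ChartedSpace E M] [IsManifold 𝓘(ℝ, E) ∞ M]

variable (E M) in
/-- Sections `Z` of the complexified tangent bundle `ℂ ⊗ TM`. -/
abbrev CField : Type _ := (x : M) → ℂ ⊗[ℝ] TangentSpace 𝓘(ℝ, E) x

/-- The real part `X` of `Z = X + iY`. -/
def CField.re (Z : CField E M) : VField E M := fun x =>
  TensorProduct.lid ℝ (TangentSpace 𝓘(ℝ, E) x)
    (LinearMap.rTensor (TangentSpace 𝓘(ℝ, E) x) Complex.reLm (Z x))

/-- The imaginary part `Y` of `Z = X + iY`. -/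
def CField.im (Z : CField E M) : VField E M := fun x =>
  TensorProduct.lid ℝ (TangentSpace 𝓘(ℝ, E) x)
    (LinearMap.rTensor (TangentSpace 𝓘(ℝ, E) x) Complex.imLm (Z x))

/-- The complex field `X + iY`. -/
def CField.mk (X Y : VField E M) : CField E M := fun x =>
  (1 : ℂ) ⊗ₜ[ℝ] X x + Complex.I ⊗ₜ[ℝ] Y x

/-- The complex vector field `Z` is smooth on the open set `U`. -/
def CField.SmoothOn (Z : CField E M) (U : Set M) : Prop :=
  SmoothFieldOn Z.re U ∧ SmoothFieldOn Z.im U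

/-- The derivative `Z g = dg(X) + i dg(Y)` of `g : M → ℂ` along `Z = X + iY`. -/
def CField.deriv (Z : CField E M) (g : M → ℂ) : M → ℂ := fun x =>
  mvfderiv 𝓘(ℝ, E) g x (Z.re x) + Complex.I * mvfderiv 𝓘(ℝ, E) g x (Z.im x)

/-- The complex bilinear extension of the connection, `∇_Z W`. -/
def nabla (cov : Connection E M) (Z W : CField E M) : CField E M :=
  CField.mk (fun x => cov W.re x (Z.re x) - cov W.im x (Z.im x))
    (fun x => cov W.im x (Z.re x) + cov W.re x (Z.im x))

/-- The complex bilinear extension of the Lie bracket, `[Z, W]`. -/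
def cBracket (Z W : CField E M) : CField E M :=
  CField.mk
    (VectorField.mlieBracket 𝓘(ℝ, E) Z.re W.re - VectorField.mlieBracket 𝓘(ℝ, E) Z.im W.im)
    (VectorField.mlieBracket 𝓘(ℝ, E) Z.re W.im + VectorField.mlieBracket 𝓘(ℝ, E) Z.im W.re)

/-- The curvature of the complexified connection,
`R(Z,W)V = ∇_Z ∇_W V - ∇_W ∇_Z V - ∇_{[Z,W]} V`. -/
def cCurvature (cov : Connection E M) (Z W V : CField E M) : CField E M :=
  nabla cov Z (nabla cov W V) - nabla cov W (nabla cov Z V) - nabla cov (cBracket Z W) V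

/-- The higher covariant derivatives `(∇ⁿ f)(Z₁, …, Zₙ)`: `∇⁰ f = f` and
`(∇ⁿ⁺¹ f)(Z₀, …, Zₙ) = (∇_{Z₀}(∇ⁿ f))(Z₁, …, Zₙ)
  = Z₀((∇ⁿ f)(Z₁, …, Zₙ)) - ∑ⱼ (∇ⁿ f)(Z₁, …, ∇_{Z₀} Zⱼ, …, Zₙ)`. -/
def iterNabla (cov : Connection E M) (f : M → ℂ) : (n : ℕ) → (Fin n → CField E M) → M → ℂ
  | 0, _ => f
  | n + 1, Z => fun x =>
      (Z 0).deriv (iterNabla cov f n (fun k => Z k.succ)) x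
        - ∑ j : Fin n, iterNabla cov f n
            (Function.update (fun k => Z k.succ) j (nabla cov (Z 0) (Z j.succ))) x

/-- The tuple `(Z₀, …, Zᵢ₋₁, Zᵢ₊₂, …, Zₙ₊₁)` obtained by deleting the entries `i` and `i + 1`. -/
def removeTwo {n : ℕ} (Z : Fin (n + 2) → CField E M) (i : Fin n) : Fin n → CField E M :=
  fun k => if k < i then Z k.castSucc.castSucc else Z k.succ.succ

end ComplexFields

end CovHess

end

/-! Exchanging the two leading slots of a second covariant derivative of a tensor gives the Ricci
identity: for a torsion-free connection the second-order terms cancel and -R acts as a derivation on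
the remaining arguments. For a function no argument remains, so its Hessian is symmetric, and
further differentiation preserves this symmetry; hence the last two arguments always commute.

An exchange deeper inside is handled by induction. Covariant differentiation commutes with permuting
the later arguments, so the exchange formula for ∇ⁿ⁻¹f may itself be differentiated. The derivative
passes through the contraction with R exactly when ∇R = 0, and no term is added. On a surface of
constant curvature R(X,Y)Z = K(⟨Y,Z⟩X - ⟨X,Z⟩Y), which is parallel because K is constant and ∇g = 0.

The algebra needs only additivity, so it is done for a biadditive action `D` of "fields" on
"functions" and a biadditive `N` for ∇ (`ricci`, `covD_curvContract`, `hess_swap`). Its two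
hypotheses, on commutators of `D` and on the derivative of `curv`, are proved for real fields
(`IsLeviCivita.derivHom_bracket`, `covHom_curv`) and pass to complex ones by bilinearity.
`iterNabla_eq_hess` identifies the two settings on U. -/

noncomputable section

namespace CovHess

/-! ### Algebra of iterated covariant derivatives -/

section Abstract

open Function

variable {V F : Type*} [AddCommGroup V] [AddCommGroup F]

/-- A function of several variables in an additive group that is additive in each of them. -/
def IsMultiAdditive {n : ℕ} (T : (Fin n → V) → F) : Prop :=
  ∀ (Z : Fin n → V) (i : Fin n) (a b : V),
    T (update Z i (a + b)) = T (update Z i a) + T (update Z i b)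

/-- The value of a multi-additive function as a homomorphism in one of its variables. -/
def IsMultiAdditive.slot {n : ℕ} {T : (Fin n → V) → F} (hT : IsMultiAdditive T) (Z : Fin n → V)
    (i : Fin n) : V →+ F :=
  AddMonoidHom.mk' (fun v => T (update Z i v)) (hT Z i)

lemma IsMultiAdditive.slot_apply {n : ℕ} {T : (Fin n → V) → F} (hT : IsMultiAdditive T)
    (Z : Fin n → V) (i : Fin n) (v : V) : hT.slot Z i v = T (update Z i v) := rfl

/-- The derivation induced on functions of several variables by an endomorphism. -/
def act (L : V → V) {n : ℕ} (T : (Fin n → V) → F) (Z : Fin n → V) : F :=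
  ∑ j, T (update Z j (L (Z j)))

omit [AddCommGroup V] in
/-- The commutator of two induced derivations. -/
lemma act_act_sub_act_act (L L' : V → V) {n : ℕ} (T : (Fin n → V) → F) (Z : Fin n → V) :
    act L (act L' T) Z - act L' (act L T) Z
      = ∑ j, (T (update Z j (L' (L (Z j)))) - T (update Z j (L (L' (Z j))))) := by
  have h : act L' (act L T) Z
      = ∑ j, ∑ k, T (update (update Z k (L' (Z k))) j (L (update Z k (L' (Z k)) j))) := by
    unfold act
    exact Finset.sum_comm
  rw [h]
  unfold act
  rw [← Finset.sum_sub_distrib]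
  refine Finset.sum_congr rfl fun j _ => ?_
  rw [← Finset.sum_sub_distrib]
  -- Substitutions in different slots commute, so only the diagonal terms survive. There the
  -- composition order is reversed, which is the source of the minus sign in front of the curvature.
  rw [Finset.sum_eq_single j]
  · simp
  · intro k _ hk
    rw [update_of_ne hk, update_of_ne hk.symm, update_comm hk, sub_self]
  · simp

variable (D : V →+ F →+ F) (N : V →+ V →+ V)

/-- The covariant derivative of a covariant tensor, with the direction as first argument. -/
def covD {n : ℕ} (T : (Fin n → V) → F) (Z : Fin (n + 1) → V) : F :=
  D (Z 0) (T (Fin.tail Z)) - act (N (Z 0)) T (Fin.tail Z)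

/-- Iterated covariant derivatives of a function. -/
def hess (φ : F) : (n : ℕ) → (Fin n → V) → F
  | 0 => fun _ => φ
  | n + 1 => covD D N (hess φ n)

/-- The curvature of `N`, with the bracket given by vanishing torsion. -/
def curv (A B C : V) : V := N A (N B C) - N B (N A C) - N (N A B - N B A) C

lemma IsMultiAdditive.covD {n : ℕ} {T : (Fin n → V) → F} (hT : IsMultiAdditive T) :
    IsMultiAdditive (covD D N T) := by
  intro Z i a b
  induction i using Fin.cases with
  | zero =>
    simp only [CovHess.covD, act, update_self, Fin.tail_update_zero, map_add, AddMonoidHom.add_apply,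
      hT _ _, Finset.sum_add_distrib]
    abel
  | succ l =>
    have h0 : ∀ v, update Z l.succ v 0 = Z 0 := fun v => update_of_ne (Fin.succ_ne_zero l).symm _ _
    simp only [CovHess.covD, act, h0, Fin.tail_update_succ, hT _ _, map_add]
    rw [sub_add_sub_comm, ← Finset.sum_add_distrib]
    congr 1
    refine Finset.sum_congr rfl fun j _ => ?_
    rcases eq_or_ne j l with rfl | hj
    · simp only [update_self, update_idem, map_add, hT _ _]
    · simp only [update_of_ne hj, update_comm hj.symm, hT _ _]

lemma isMultiAdditive_hess (φ : F) : ∀ n, IsMultiAdditive (hess D N φ n)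
  | 0 => fun _ i => i.elim0
  | n + 1 => (isMultiAdditive_hess φ n).covD D N

/-- The terms are grouped so that the final bracket is symmetric in `A` and `B` and drops out on
antisymmetrizing. -/
lemma covD_covD {n : ℕ} (T : (Fin n → V) → F) (A B : V) (Z : Fin n → V) :
    covD D N (covD D N T) (Fin.cons A (Fin.cons B Z))
      = D A (D B (T Z)) - D (N A B) (T Z) + act (N (N A B)) T Z + act (N A) (act (N B) T) Z
        - (D A (act (N B) T Z) + D B (act (N A) T Z)) := by
  have h : act (N A) (covD D N T) (Fin.cons B Z)
      = D (N A B) (T Z) - act (N (N A B)) T Z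
        + (D B (act (N A) T Z) - act (N A) (act (N B) T) Z) := by
    unfold act
    rw [Fin.sum_univ_succ, map_sum, ← Finset.sum_sub_distrib]
    congr 1
    refine Finset.sum_congr rfl fun j _ => ?_
    rw [Fin.cons_succ, ← Fin.cons_update]
    simp only [covD, Fin.cons_zero, Fin.tail_cons, act]
  rw [covD, Fin.cons_zero, Fin.tail_cons, h, covD, Fin.cons_zero, Fin.tail_cons, map_sub]
  abel

/-- The Ricci identity. -/
lemma ricci (hD : ∀ A B φ, D A (D B φ) - D B (D A φ) = D (N A B - N B A) φ)
    {n : ℕ} {T : (Fin n → V) → F} (hT : IsMultiAdditive T) (A B : V) (Z : Fin n → V) :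
    covD D N (covD D N T) (Fin.cons A (Fin.cons B Z))
        - covD D N (covD D N T) (Fin.cons B (Fin.cons A Z))
      = ∑ j, T (update Z j (-curv N A B (Z j))) := by
  have h1 := hD A B (T Z)
  have h2 := act_act_sub_act_act (N A) (N B) T Z
  have h3 : ∑ j, T (update Z j (-curv N A B (Z j)))
      = act (N (N A B)) T Z - act (N (N B A)) T Z
        + ∑ j, (T (update Z j (N B (N A (Z j)))) - T (update Z j (N A (N B (Z j))))) := by
    unfold act
    rw [← Finset.sum_sub_distrib, ← Finset.sum_add_distrib]
    refine Finset.sum_congr rfl fun j _ => ?_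
    simp only [← hT.slot_apply, curv, map_sub, map_neg, AddMonoidHom.sub_apply]
    abel
  rw [covD_covD, covD_covD, h3, ← h2]
  rw [map_sub, AddMonoidHom.sub_apply, ← sub_eq_zero] at h1
  rw [← sub_eq_zero, ← h1]
  abel

/-- Differentiation along the first argument treats all later arguments alike: permuting them only
reindexes the sum in `act`. -/
lemma covD_sub_covD_swap {n : ℕ} (S : (Fin n → V) → F) (a b : Fin n) (Z : Fin (n + 1) → V) :
    covD D N S Z - covD D N S (Z ∘ Equiv.swap a.succ b.succ)
      = covD D N (fun Y => S Y - S (Y ∘ Equiv.swap a b)) Z := by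
  have h0 : (Z ∘ Equiv.swap a.succ b.succ) 0 = Z 0 := by
    rw [comp_apply, Equiv.swap_apply_of_ne_of_ne (Fin.succ_ne_zero a).symm
      (Fin.succ_ne_zero b).symm]
  have ht : Fin.tail (Z ∘ Equiv.swap a.succ b.succ) = Fin.tail Z ∘ Equiv.swap a b := by
    funext k
    simp only [Fin.tail, comp_apply]
    rw [(Fin.succ_injective n).swap_apply]
  have hs : act (N (Z 0)) S (Fin.tail Z ∘ Equiv.swap a b)
      = ∑ j, S (update (Fin.tail Z) j (N (Z 0) (Fin.tail Z j)) ∘ Equiv.swap a b) := by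
    unfold act
    rw [← Equiv.sum_comp (Equiv.swap a b)
      (fun j => S (update (Fin.tail Z) j (N (Z 0) (Fin.tail Z j)) ∘ Equiv.swap a b))]
    refine Finset.sum_congr rfl fun j _ => ?_
    rw [update_comp_equiv, Equiv.symm_apply_apply, comp_apply]
  unfold covD
  rw [h0, ht, hs]
  simp only [act, map_sub, Finset.sum_sub_distrib]
  abel

/-- The order of the last two arguments of an iterated covariant derivative is immaterial. -/
lemma hess_swap_last (hD : ∀ A B φ, D A (D B φ) - D B (D A φ) = D (N A B - N B A) φ) (φ : F)
    (n : ℕ) (Z : Fin (n + 2) → V) :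
    hess D N φ (n + 2) Z
      - hess D N φ (n + 2) (Z ∘ Equiv.swap (Fin.last n).castSucc (Fin.last (n + 1))) = 0 := by
  induction n with
  | zero =>
    -- With no further arguments the curvature sum is empty: this is the symmetry of the Hessian.
    have h := ricci D N hD (isMultiAdditive_hess D N φ 0) (Z 0) (Z 1) (fun i => i.elim0)
    rw [Finset.univ_eq_empty, Finset.sum_empty] at h
    have e1 : Z = Fin.cons (Z 0) (Fin.cons (Z 1) (fun i => i.elim0)) := by
      funext k; fin_cases k <;> rfl
    have e2 : Z ∘ Equiv.swap (Fin.last 0).castSucc (Fin.last (0 + 1))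
        = Fin.cons (Z 1) (Fin.cons (Z 0) (fun i => i.elim0)) := by
      funext k; fin_cases k <;> rfl
    rw [← e1, ← e2] at h
    exact h
  | succ m ih =>
    have h := covD_sub_covD_swap D N (hess D N φ (m + 2)) (Fin.last m).castSucc (Fin.last (m + 1)) Z
    -- By induction the tensor being differentiated is identically zero.
    simp only [ih] at h
    refine Eq.trans h ?_
    simp [covD, act]

/-- The embedding of `Fin n` into `Fin (n + 2)` that omits `i` and `i + 1`. -/
def skipTwo {n : ℕ} (i : Fin n) (k : Fin n) : Fin (n + 2) :=
  i.castSucc.castSucc.succAbove (i.castSucc.succAbove k)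

lemma skipTwo_injective {n : ℕ} (i : Fin n) : Injective (skipTwo i) :=
  Fin.succAbove_right_injective.comp Fin.succAbove_right_injective

/-- Links the `succAbove` form, from which injectivity and the splitting of sums are immediate, with
the case distinction used in `removeTwo`. -/
lemma skipTwo_eq_ite {n : ℕ} (i k : Fin n) :
    skipTwo i k = if k < i then k.castSucc.castSucc else k.succ.succ := by
  unfold skipTwo
  split_ifs with h
  · rw [Fin.succAbove_of_castSucc_lt i.castSucc k (Fin.castSucc_lt_castSucc_iff.2 h),
      Fin.succAbove_of_castSucc_lt _ _ (Fin.castSucc_lt_castSucc_iff.2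
        (Fin.castSucc_lt_castSucc_iff.2 h))]
  · rw [not_lt] at h
    rw [Fin.succAbove_of_le_castSucc i.castSucc k (Fin.castSucc_le_castSucc_iff.2 h),
      Fin.succAbove_of_le_castSucc]
    exact Fin.castSucc_le_castSucc_iff.2
      ((Fin.castSucc_le_castSucc_iff.2 h).trans Fin.castSucc_lt_succ.le)

lemma castSucc_succAbove_castSucc_self {n : ℕ} (i : Fin n) :
    i.castSucc.castSucc.succAbove i.castSucc = i.succ.castSucc := by
  rw [Fin.succAbove_castSucc_self, Fin.succ_castSucc]

lemma skipTwo_ne_left {n : ℕ} (i k : Fin n) : skipTwo i k ≠ i.castSucc.castSucc :=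
  Fin.succAbove_ne _ _

lemma skipTwo_ne_right {n : ℕ} (i k : Fin n) : skipTwo i k ≠ i.succ.castSucc := by
  rw [← castSucc_succAbove_castSucc_self]
  exact fun h => Fin.succAbove_ne _ _ (Fin.succAbove_right_injective h)

lemma sum_eq_add_add_sum_skipTwo {n : ℕ} (i : Fin n) (G : Fin (n + 2) → F) :
    ∑ j, G j = G i.castSucc.castSucc + G i.succ.castSucc + ∑ l, G (skipTwo i l) := by
  rw [Fin.sum_univ_succAbove _ i.castSucc.castSucc, Fin.sum_univ_succAbove _ i.castSucc,
    castSucc_succAbove_castSucc_self, add_assoc]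
  rfl

/-- The contraction of a tensor with the curvature in the `k`-th argument. -/
def curvContract (i : Fin n) (k : Fin n) (T : (Fin n → V) → F) (Z : Fin (n + 2) → V) : F :=
  T (update (Z ∘ skipTwo i) k
    (-curv N (Z i.castSucc.castSucc) (Z i.succ.castSucc) (Z (skipTwo i k))))

/-- Covariant differentiation commutes with contraction with a parallel curvature. -/
lemma covD_curvContract
    (hN : ∀ X A B C, N X (curv N A B C)
      = curv N (N X A) B C + curv N A (N X B) C + curv N A B (N X C))
    {n : ℕ} (i k : Fin n) {T : (Fin n → V) → F} (hT : IsMultiAdditive T) (X : V)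
    (Z : Fin (n + 2) → V) :
    covD D N (curvContract N i k T) (Fin.cons X Z)
      = covD D N T (Fin.cons X (update (Z ∘ skipTwo i) k
          (-curv N (Z i.castSucc.castSucc) (Z i.succ.castSucc) (Z (skipTwo i k))))) := by
  have hab : i.castSucc.castSucc ≠ i.succ.castSucc := by
    rw [← castSucc_succAbove_castSucc_self]
    exact (Fin.succAbove_ne _ _).symm
  have ha := skipTwo_ne_left i
  have hb := skipTwo_ne_right i
  have hp := skipTwo_injective i
  rw [covD, covD, Fin.cons_zero, Fin.cons_zero, Fin.tail_cons, Fin.tail_cons]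
  congr 1
  unfold act
  rw [sum_eq_add_add_sum_skipTwo i, ← Finset.add_sum_erase _ _ (Finset.mem_univ k),
    ← Finset.add_sum_erase _ _ (Finset.mem_univ k), ← add_assoc]
  congr 1
  -- The slots `i`, `i + 1` and `skipTwo i k` feed the three arguments of the curvature. By `hN`
  -- their terms add up to `N X` applied to the curvature, the term of slot `k` on the right.
  · rw [update_self, update_idem]
    simp only [curvContract]
    rw [update_comp_eq_of_forall_ne _ _ (fun l => (ha l)),
      update_comp_eq_of_forall_ne _ _ (fun l => (hb l)), update_comp_eq_of_injective _ hp,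
      update_idem]
    simp only [update_self, update_of_ne hab, update_of_ne hab.symm, update_of_ne (ha _),
      update_of_ne (hb _), update_of_ne (ha _).symm, update_of_ne (hb _).symm]
    simp only [← hT.slot_apply, map_neg, hN, map_add]
    abel
  · refine Finset.sum_congr rfl fun l hl => ?_
    have hl : l ≠ k := Finset.ne_of_mem_erase hl
    simp only [curvContract]
    rw [update_comp_eq_of_injective _ hp, update_of_ne (ha _).symm, update_of_ne (hb _).symm,
      update_of_ne (hp.ne hl.symm), update_of_ne hl, update_comm hl]
    rfl

lemma covD_sum {ι : Type*} (s : Finset ι) {n : ℕ} (T : ι → (Fin n → V) → F)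
    (Z : Fin (n + 1) → V) :
    covD D N (fun Y => ∑ k ∈ s, T k Y) Z = ∑ k ∈ s, covD D N (T k) Z := by
  simp only [covD, act, map_sum, Finset.sum_sub_distrib]
  rw [Finset.sum_comm]

/-- Exchanging two adjacent arguments of an iterated covariant derivative. -/
lemma hess_swap (hD : ∀ A B φ, D A (D B φ) - D B (D A φ) = D (N A B - N B A) φ)
    (hN : ∀ X A B C, N X (curv N A B C)
      = curv N (N X A) B C + curv N A (N X B) C + curv N A B (N X C)) (φ : F)
    (n : ℕ) (i : Fin n) (Z : Fin (n + 2) → V) :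
    hess D N φ (n + 2) Z
        - hess D N φ (n + 2) (Z ∘ Equiv.swap i.castSucc.castSucc i.succ.castSucc)
      = ∑ j ∈ Finset.Ici i, curvContract N i j (hess D N φ n) Z := by
  induction n with
  | zero => exact i.elim0
  | succ m ih =>
    induction i using Fin.cases with
    | zero =>
      -- An exchange in front is the Ricci identity for the tensor ∇ᵐ⁺¹φ, with every remaining slot
      -- contributing.
      have h := ricci D N hD (isMultiAdditive_hess D N φ (m + 1)) (Z 0) (Z 1)
        (Fin.tail (Fin.tail Z))
      have hI : Finset.Ici (0 : Fin (m + 1)) = Finset.univ := by ext; simp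
      have e1 : Z = Fin.cons (Z 0) (Fin.cons (Z 1) (Fin.tail (Fin.tail Z))) := by
        funext k
        refine Fin.cases rfl (fun k => Fin.cases rfl (fun k => rfl) k) k
      have e2 : Z ∘ Equiv.swap (0 : Fin (m + 1)).castSucc.castSucc (0 : Fin (m + 1)).succ.castSucc
          = Fin.cons (Z 1) (Fin.cons (Z 0) (Fin.tail (Fin.tail Z))) := by
        funext k
        refine Fin.cases ?_ (fun k => Fin.cases ?_ (fun k => ?_) k) k
        · exact congrArg Z (Equiv.swap_apply_left _ _)
        · exact congrArg Z (Equiv.swap_apply_right _ _)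
        · exact congrArg Z (Equiv.swap_apply_of_ne_of_ne (Fin.succ_ne_zero _)
            fun hk => Fin.succ_ne_zero k (Fin.succ_injective _ hk))
      have e3 : ∀ k, skipTwo (0 : Fin (m + 1)) k = k.succ.succ := fun k => by
        rw [skipTwo_eq_ite, if_neg (Fin.not_lt_zero k)]
      have e4 : Z ∘ skipTwo (0 : Fin (m + 1)) = Fin.tail (Fin.tail Z) := by
        funext k
        rw [comp_apply, e3]
        rfl
      rw [← e1] at h
      rw [e2, hI]
      refine Eq.trans h (Finset.sum_congr rfl fun j _ => ?_)
      rw [curvContract, e4, e3]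
      rfl
    | succ i =>
      have h := covD_sub_covD_swap D N (hess D N φ (m + 2)) i.castSucc.castSucc i.succ.castSucc Z
      -- The exchange formula one order lower holds for all arguments, so it may be differentiated
      -- along `Z 0`; `covD_curvContract` then handles each summand, with all indices shifted by
      -- one.
      simp only [ih] at h
      refine Eq.trans h ?_
      rw [covD_sum]
      have hI : Finset.Ici i.succ = (Finset.Ici i).map (Fin.succEmb m) :=
        (Fin.map_succEmb_Ici i).symm
      rw [hI, Finset.sum_map]
      refine Finset.sum_congr rfl fun k _ => ?_
      have h2 := covD_curvContract D N hN i k (isMultiAdditive_hess D N φ m) (Z 0) (Fin.tail Z)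
      rw [Fin.cons_self_tail] at h2
      rw [h2, curvContract]
      have e3 : ∀ l, skipTwo i.succ (Fin.succ l) = (skipTwo i l).succ := fun l => by
        rw [skipTwo_eq_ite, skipTwo_eq_ite]
        simp only [Fin.succ_lt_succ_iff]
        split_ifs <;> rfl
      have e4 : Z ∘ skipTwo i.succ = Fin.cons (Z 0) (Fin.tail Z ∘ skipTwo i) := by
        funext l
        refine Fin.cases ?_ (fun l => ?_) l
        · rw [comp_apply, skipTwo_eq_ite, if_pos (Fin.succ_pos i)]
          rfl
        · rw [comp_apply, e3]
          rfl
      rw [e4, Fin.coe_succEmb, ← Fin.cons_update, e3]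
      rfl

/-! ### Complexification of the algebra -/

/-- The complex bilinear extension of a biadditive operation, on pairs of real and imaginary
parts. -/
def complexify : V × V →+ V × V →+ V × V :=
  AddMonoidHom.mk' (fun Z => AddMonoidHom.mk'
    (fun W => (N Z.1 W.1 - N Z.2 W.2, N Z.1 W.2 + N Z.2 W.1))
    (fun W W' => by
      ext <;> simp only [Prod.fst_add, Prod.snd_add, map_add] <;> abel))
    (fun Z Z' => by
      ext W <;> simp only [AddMonoidHom.mk'_apply, Prod.fst_add, Prod.snd_add, map_add,
        AddMonoidHom.add_apply] <;> abel)

lemma complexify_apply (Z W : V × V) :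
    complexify N Z W = (N Z.1 W.1 - N Z.2 W.2, N Z.1 W.2 + N Z.2 W.1) := rfl

/-- The complex linear extension of an action by directional derivatives, where `J` is the
multiplication by the imaginary unit. -/
def complexifyDeriv (J : F →+ F) : V × V →+ F →+ F :=
  AddMonoidHom.mk' (fun Z => D Z.1 + J.comp (D Z.2))
    (fun Z Z' => by
      ext φ
      simp only [Prod.fst_add, Prod.snd_add, map_add, AddMonoidHom.add_apply,
        AddMonoidHom.comp_apply]
      abel)

lemma complexifyDeriv_apply (J : F →+ F) (Z : V × V) (φ : F) :
    complexifyDeriv D J Z φ = D Z.1 φ + J (D Z.2 φ) := rfl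

lemma complexifyDeriv_bracket {J : F →+ F} (hJ : ∀ φ, J (J φ) = -φ)
    (hDJ : ∀ A φ, D A (J φ) = J (D A φ))
    (hD : ∀ A B φ, D A (D B φ) - D B (D A φ) = D (N A B - N B A) φ) (A B : V × V) (φ : F) :
    complexifyDeriv D J A (complexifyDeriv D J B φ)
        - complexifyDeriv D J B (complexifyDeriv D J A φ)
      = complexifyDeriv D J (complexify N A B - complexify N B A) φ := by
  simp only [complexifyDeriv_apply, complexify_apply, Prod.fst_sub, Prod.snd_sub, map_add, hDJ, hJ]
  have h11 := hD A.1 B.1 φ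
  have h22 := hD A.2 B.2 φ
  have h12 := congrArg J (hD A.1 B.2 φ)
  have h21 := congrArg J (hD A.2 B.1 φ)
  simp only [map_sub, map_add, AddMonoidHom.sub_apply, AddMonoidHom.add_apply] at h11 h22 h12 h21 ⊢
  rw [sub_eq_iff_eq_add] at h11 h22 h12 h21
  rw [h11, h22, h12, h21]
  abel

/-- The curvature is triadditive, so it expands like the product (A₁ + iA₂)(B₁ + iB₂)(C₁ + iC₂);
this reduces parallelism to the real case. -/
lemma curv_complexify (A B C : V × V) :
    curv (complexify N) A B C
      = (curv N A.1 B.1 C.1 - curv N A.1 B.2 C.2 - curv N A.2 B.1 C.2 - curv N A.2 B.2 C.1,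
        curv N A.1 B.1 C.2 + curv N A.1 B.2 C.1 + curv N A.2 B.1 C.1 - curv N A.2 B.2 C.2) := by
  ext <;> simp only [curv, complexify_apply, Prod.fst_sub, Prod.snd_sub, map_sub, map_add,
    AddMonoidHom.sub_apply, AddMonoidHom.add_apply] <;> abel

lemma curv_add_left (A A' B C : V) : curv N (A + A') B C = curv N A B C + curv N A' B C := by
  simp only [curv, map_sub, map_add, AddMonoidHom.sub_apply, AddMonoidHom.add_apply]; abel

lemma curv_sub_left (A A' B C : V) : curv N (A - A') B C = curv N A B C - curv N A' B C := by
  simp only [curv, map_sub, AddMonoidHom.sub_apply]; abel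

lemma curv_add_mid (A B B' C : V) : curv N A (B + B') C = curv N A B C + curv N A B' C := by
  simp only [curv, map_sub, map_add, AddMonoidHom.sub_apply, AddMonoidHom.add_apply]; abel

lemma curv_sub_mid (A B B' C : V) : curv N A (B - B') C = curv N A B C - curv N A B' C := by
  simp only [curv, map_sub, AddMonoidHom.sub_apply]; abel

lemma curv_add_right (A B C C' : V) : curv N A B (C + C') = curv N A B C + curv N A B C' := by
  simp only [curv, map_add]; abel

lemma curv_sub_right (A B C C' : V) : curv N A B (C - C') = curv N A B C - curv N A B C' := by
  simp only [curv, map_sub]; abel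

lemma parallel_complexify
    (hN : ∀ X A B C, N X (curv N A B C)
      = curv N (N X A) B C + curv N A (N X B) C + curv N A B (N X C)) (X A B C : V × V) :
    complexify N X (curv (complexify N) A B C)
      = curv (complexify N) (complexify N X A) B C + curv (complexify N) A (complexify N X B) C
        + curv (complexify N) A B (complexify N X C) := by
  ext <;> simp only [curv_complexify, complexify_apply, Prod.fst_add, Prod.snd_add, map_sub,
    map_add, hN, curv_add_left, curv_sub_left, curv_add_mid, curv_sub_mid, curv_add_right,
    curv_sub_right] <;> abel

end Abstract

/-! ### Directional derivatives and the Lie bracket -/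

section Calculus

open Set Filter Topology

variable {E : Type*} [NormedAddCommGroup E] [NormedSpace ℝ E]
  {M : Type*} [TopologicalSpace M] [ChartedSpace E M] [IsManifold 𝓘(ℝ, E) ∞ M]
  {F : Type*} [NormedAddCommGroup F] [NormedSpace ℝ F]

omit [IsManifold 𝓘(ℝ, E) ∞ M] in
lemma mvfderiv_congr_of_eqOn {f f' : M → F} {U : Set M} (hU : IsOpen U) (h : EqOn f f' U) {x : M}
    (hx : x ∈ U) : mvfderiv 𝓘(ℝ, E) f x = mvfderiv 𝓘(ℝ, E) f' x := by
  have h' : f =ᶠ[𝓝 x] f' := h.eventuallyEq_of_mem (hU.mem_nhds hx)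
  have e : mfderiv 𝓘(ℝ, E) 𝓘(ℝ, F) f x = mfderiv 𝓘(ℝ, E) 𝓘(ℝ, F) f' x := h'.mfderiv_eq
  ext v
  exact DFunLike.congr_fun e v

lemma SmoothFieldOn.mdifferentiableAt {X : VField E M} {U : Set M} (hX : SmoothFieldOn X U)
    (hU : IsOpen U) {x : M} (hx : x ∈ U) :
    MDifferentiableAt 𝓘(ℝ, E) (𝓘(ℝ, E).prod 𝓘(ℝ, E))
      (fun y => (⟨y, X y⟩ : TangentBundle 𝓘(ℝ, E) M)) x :=
  (hX.contMDiffAt (hU.mem_nhds hx)).mdifferentiableAt (by simp)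

omit [IsManifold 𝓘(ℝ, E) ∞ M] in
lemma mdifferentiableAt_of_contMDiffOn {f : M → F} {U : Set M} (hU : IsOpen U)
    (hf : ContMDiffOn 𝓘(ℝ, E) 𝓘(ℝ, F) ∞ f U) {x : M} (hx : x ∈ U) :
    MDifferentiableAt 𝓘(ℝ, E) 𝓘(ℝ, F) f x :=
  (hf.contMDiffAt (hU.mem_nhds hx)).mdifferentiableAt (by simp)

/-- The derivative of a smooth function along a smooth vector field is smooth. -/
lemma contMDiffOn_mvfderiv_apply {f : M → F} {X : VField E M} {U : Set M} (hU : IsOpen U)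
    (hf : ContMDiffOn 𝓘(ℝ, E) 𝓘(ℝ, F) ∞ f U) (hX : SmoothFieldOn X U) :
    ContMDiffOn 𝓘(ℝ, E) 𝓘(ℝ, F) ∞ (fun x => mvfderiv 𝓘(ℝ, E) f x (X x)) U := by
  -- df(X) is the fibre component of the tangent map of `f` composed with the section `X`.
  have h1 := hf.contMDiffOn_tangentMapWithin (m := ∞) (by simp) hU.uniqueMDiffOn
  have h2 := h1.comp hX (fun x hx => hx)
  have h3 := (contMDiff_snd_tangentBundle_modelSpace (n := ∞) F 𝓘(ℝ, F)).comp_contMDiffOn h2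
  refine h3.congr fun x hx => ?_
  change mvfderiv 𝓘(ℝ, E) f x (X x) = mfderivWithin 𝓘(ℝ, E) 𝓘(ℝ, F) f U x (X x)
  rw [mfderivWithin_of_isOpen hU hx]
  rfl

/-- Chain rule: pulling `X` back applies the inverse of the derivative of the inverse chart, which
cancels against that derivative. -/
lemma fderiv_comp_extChartAt_symm_mpullback {x : M} {h : M → F} (X : VField E M) {y : E}
    (hy : y ∈ (extChartAt 𝓘(ℝ, E) x).target)
    (hh : MDifferentiableAt 𝓘(ℝ, E) 𝓘(ℝ, F) h ((extChartAt 𝓘(ℝ, E) x).symm y)) :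
    fderiv ℝ (h ∘ (extChartAt 𝓘(ℝ, E) x).symm) y
        (VectorField.mpullbackWithin 𝓘(ℝ, E) 𝓘(ℝ, E) (extChartAt 𝓘(ℝ, E) x).symm X
          (range 𝓘(ℝ, E)) y)
      = mvfderiv 𝓘(ℝ, E) h ((extChartAt 𝓘(ℝ, E) x).symm y)
          (X ((extChartAt 𝓘(ℝ, E) x).symm y)) := by
  have hinv := isInvertible_mfderivWithin_extChartAt_symm hy
  have hs : MDifferentiableWithinAt 𝓘(ℝ, E) 𝓘(ℝ, E) (extChartAt 𝓘(ℝ, E) x).symm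
      (range 𝓘(ℝ, E)) y := mdifferentiableWithinAt_extChartAt_symm hy
  have hu : UniqueMDiffWithinAt 𝓘(ℝ, E) (range 𝓘(ℝ, E)) y := by
    simpa using uniqueMDiffWithinAt_univ 𝓘(ℝ, E)
  have hc := mfderiv_comp_mfderivWithin y hh hs hu
  have hr : range 𝓘(ℝ, E) = univ := by simp
  obtain ⟨A, hA⟩ := hinv
  rw [VectorField.mpullbackWithin_apply, ← hA, ContinuousLinearMap.inverse_equiv]
  rw [← hA] at hc
  have hd : mfderivWithin 𝓘(ℝ, E) 𝓘(ℝ, F) (h ∘ (extChartAt 𝓘(ℝ, E) x).symm) (range 𝓘(ℝ, E)) y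
      = fderiv ℝ (h ∘ (extChartAt 𝓘(ℝ, E) x).symm) y := by
    rw [hr, mfderivWithin_univ, mfderiv_eq_fderiv]
  have he := DFunLike.congr_fun (hd.symm.trans hc)
    (A.symm (X ((extChartAt 𝓘(ℝ, E) x).symm y)))
  refine he.trans ?_
  exact congrArg (mvfderiv 𝓘(ℝ, E) h ((extChartAt 𝓘(ℝ, E) x).symm y))
    (A.apply_symm_apply (X ((extChartAt 𝓘(ℝ, E) x).symm y)))

lemma differentiableAt_mpullbackWithin [CompleteSpace E] {X : VField E M} {x : M}
    (hX : MDifferentiableAt 𝓘(ℝ, E) (𝓘(ℝ, E).prod 𝓘(ℝ, E))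
      (fun y => (⟨y, X y⟩ : TangentBundle 𝓘(ℝ, E) M)) x) :
    DifferentiableAt ℝ (VectorField.mpullbackWithin 𝓘(ℝ, E) 𝓘(ℝ, E)
      (extChartAt 𝓘(ℝ, E) x).symm X (range 𝓘(ℝ, E)) : E → E) (extChartAt 𝓘(ℝ, E) x x) := by
  have : IsManifold 𝓘(ℝ, E) 2 M := IsManifold.of_le (n := ∞) (by norm_cast)
  have h := MDifferentiableWithinAt.differentiableWithinAt_mpullbackWithin_vectorField
    (s := univ) hX.mdifferentiableWithinAt
  rw [preimage_univ, univ_inter] at h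
  exact h.differentiableAt (by simp)

/-- The Lie bracket of vector fields is the commutator of the directional derivatives. -/
lemma mvfderiv_mlieBracket [CompleteSpace E] {f : M → F} {X Y : VField E M} {U : Set M}
    (hU : IsOpen U) (hf : ContMDiffOn 𝓘(ℝ, E) 𝓘(ℝ, F) ∞ f U) (hX : SmoothFieldOn X U)
    (hY : SmoothFieldOn Y U) {x : M} (hx : x ∈ U) :
    mvfderiv 𝓘(ℝ, E) f x (VectorField.mlieBracket 𝓘(ℝ, E) X Y x)
      = mvfderiv 𝓘(ℝ, E) (fun y => mvfderiv 𝓘(ℝ, E) f y (Y y)) x (X x)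
        - mvfderiv 𝓘(ℝ, E) (fun y => mvfderiv 𝓘(ℝ, E) f y (X y)) x (Y x) := by
  set φ := extChartAt 𝓘(ℝ, E) x
  have hxs : φ.symm (φ x) = x := extChartAt_to_inv x
  let P : VField E M → E → E := fun W =>
    VectorField.mpullbackWithin 𝓘(ℝ, E) 𝓘(ℝ, E) φ.symm W (range 𝓘(ℝ, E))
  have hmem : ∀ᶠ y in 𝓝 (φ x), y ∈ φ.target ∧ φ.symm y ∈ U := by
    have hc : ContinuousAt φ.symm (φ x) := continuousAt_extChartAt_symm x
    have h1 : ∀ᶠ y in 𝓝 (φ x), y ∈ φ.target := extChartAt_target_mem_nhds x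
    exact h1.and (hc.eventually (by rw [hxs]; exact hU.mem_nhds hx))
  have hmd : ∀ h : M → F, ContMDiffOn 𝓘(ℝ, E) 𝓘(ℝ, F) ∞ h U → ∀ W : VField E M,
      ∀ᶠ y in 𝓝 (φ x), fderiv ℝ (h ∘ φ.symm) y (P W y)
        = mvfderiv 𝓘(ℝ, E) h (φ.symm y) (W (φ.symm y)) := fun h hh W => by
    filter_upwards [hmem] with y hy
    exact fderiv_comp_extChartAt_symm_mpullback W hy.1 (mdifferentiableAt_of_contMDiffOn hU hh hy.2)
  have hcd : ContDiffAt ℝ 2 (f ∘ φ.symm) (φ x) := by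
    have h1 : ContMDiffAt 𝓘(ℝ, E) 𝓘(ℝ, F) ∞ f (φ.symm (φ x)) := by
      rw [hxs]; exact hf.contMDiffAt (hU.mem_nhds hx)
    have h2 : ContMDiffAt 𝓘(ℝ, E) 𝓘(ℝ, E) ∞ φ.symm (φ x) :=
      (contMDiffOn_extChartAt_symm x).contMDiffAt (extChartAt_target_mem_nhds x)
    exact (h1.comp _ h2).contDiffAt.of_le (by norm_cast)
  have hdd : DifferentiableAt ℝ (fderiv ℝ (f ∘ φ.symm)) (φ x) :=
    (hcd.fderiv_right (m := 1) (by norm_num)).differentiableAt (by simp)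
  -- Product rule in the chart. The second-derivative term is symmetric in the two fields, so
  -- antisymmetrizing leaves only the first-order terms, which form the bracket.
  have hsecond : ∀ W₁ W₂ : VField E M, SmoothFieldOn W₂ U →
      mvfderiv 𝓘(ℝ, E) (fun y => mvfderiv 𝓘(ℝ, E) f y (W₂ y)) x (W₁ x)
        = fderiv ℝ (fderiv ℝ (f ∘ φ.symm)) (φ x) (P W₁ (φ x)) (P W₂ (φ x))
          + fderiv ℝ (f ∘ φ.symm) (φ x) (fderiv ℝ (P W₂) (φ x) (P W₁ (φ x))) := by
    intro W₁ W₂ hW₂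
    have h1 := (hmd _ (contMDiffOn_mvfderiv_apply hU hf hW₂) W₁).self_of_nhds
    rw [hxs] at h1
    rw [← h1]
    have h2 : ((fun y => mvfderiv 𝓘(ℝ, E) f y (W₂ y)) ∘ φ.symm)
        =ᶠ[𝓝 (φ x)] fun y => fderiv ℝ (f ∘ φ.symm) y (P W₂ y) := by
      filter_upwards [hmd f hf W₂] with y hy using hy.symm
    have hd : DifferentiableAt ℝ (P W₂) (φ x) :=
      differentiableAt_mpullbackWithin (hW₂.mdifferentiableAt hU hx)
    rw [h2.fderiv_eq, fderiv_clm_apply hdd hd]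
    simp only [_root_.add_apply, ContinuousLinearMap.comp_apply,
      ContinuousLinearMap.flip_apply]
    rw [add_comm]
  have hb : mvfderiv 𝓘(ℝ, E) f x (VectorField.mlieBracket 𝓘(ℝ, E) X Y x)
      = fderiv ℝ (f ∘ φ.symm) (φ x)
        (fderiv ℝ (P Y) (φ x) (P X (φ x)) - fderiv ℝ (P X) (φ x) (P Y (φ x))) := by
    have hinv : (mfderiv 𝓘(ℝ, E) 𝓘(ℝ, E) φ x).IsInvertible :=
      isInvertible_mfderiv_extChartAt (mem_extChartAt_source x)
    have hφd : MDifferentiableAt 𝓘(ℝ, E) 𝓘(ℝ, E) φ x :=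
      mdifferentiableAt_extChartAt (mem_chart_source E x)
    have hfd : MDifferentiableAt 𝓘(ℝ, E) 𝓘(ℝ, F) (f ∘ φ.symm) (φ x) :=
      (hcd.differentiableAt (by simp)).mdifferentiableAt
    have hc := mfderiv_comp x hfd hφd
    have hff : (f ∘ φ.symm) ∘ φ =ᶠ[𝓝 x] f := by
      filter_upwards [extChartAt_source_mem_nhds (I := 𝓘(ℝ, E)) x] with y hy
      exact congrArg f (φ.left_inv hy)
    rw [hff.mfderiv_eq, mfderiv_eq_fderiv] at hc
    have hl : VectorField.mlieBracket 𝓘(ℝ, E) X Y x = (mfderiv 𝓘(ℝ, E) 𝓘(ℝ, E) φ x).inverse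
        (fderiv ℝ (P Y) (φ x) (P X (φ x)) - fderiv ℝ (P X) (φ x) (P Y (φ x))) := by
      rw [← VectorField.mlieBracketWithin_univ, VectorField.mlieBracketWithin_apply]
      rw [preimage_univ, univ_inter]
      have hbr : VectorField.lieBracketWithin ℝ (P X) (P Y) (range 𝓘(ℝ, E)) (φ x)
          = fderiv ℝ (P Y) (φ x) (P X (φ x)) - fderiv ℝ (P X) (φ x) (P Y (φ x)) := by
        rw [show range 𝓘(ℝ, E) = univ by simp, VectorField.lieBracketWithin_univ]
        rfl
      exact congrArg (mfderiv 𝓘(ℝ, E) 𝓘(ℝ, E) φ x).inverse hbr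
    rw [hl]
    refine (DFunLike.congr_fun hc _).trans ?_
    exact congrArg (fderiv ℝ (f ∘ φ.symm) (φ x)) (hinv.self_apply_inverse _)
  have hsymm : fderiv ℝ (fderiv ℝ (f ∘ φ.symm)) (φ x) (P X (φ x)) (P Y (φ x))
      = fderiv ℝ (fderiv ℝ (f ∘ φ.symm)) (φ x) (P Y (φ x)) (P X (φ x)) :=
    (hcd.isSymmSndFDerivAt (by simp)).eq _ _
  rw [hb, hsecond X Y hY, hsecond Y X hX, hsymm, map_sub]
  abel

end Calculus

/-! ### Smoothness and locality of the connection, skewness of curvature -/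

section Geometry

open Set Filter Topology

variable {E : Type*} [NormedAddCommGroup E] [NormedSpace ℝ E]
  {M : Type*} [TopologicalSpace M] [ChartedSpace E M] [IsManifold 𝓘(ℝ, E) ∞ M]

lemma SmoothFieldOn.congr {X Y : VField E M} {U : Set M} (hX : SmoothFieldOn X U)
    (h : ∀ x ∈ U, Y x = X x) : SmoothFieldOn Y U :=
  ContMDiffOn.congr hX fun x hx => by rw [h x hx]

lemma SmoothFieldOn.add {X Y : VField E M} {U : Set M} (hX : SmoothFieldOn X U)
    (hY : SmoothFieldOn Y U) : SmoothFieldOn (X + Y) U :=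
  ContMDiffOn.add_section hX hY

lemma SmoothFieldOn.neg {X : VField E M} {U : Set M} (hX : SmoothFieldOn X U) :
    SmoothFieldOn (-X) U :=
  ContMDiffOn.neg_section hX

lemma smoothFieldOn_zero (U : Set M) : SmoothFieldOn (0 : VField E M) U :=
  (contMDiff_zeroSection ℝ (TangentSpace 𝓘(ℝ, E) (M := M))).contMDiffOn

lemma SmoothFieldOn.smul {φ : M → ℝ} {X : VField E M} {U : Set M}
    (hφ : ContMDiffOn 𝓘(ℝ, E) 𝓘(ℝ, ℝ) ∞ φ U) (hX : SmoothFieldOn X U) :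
    SmoothFieldOn (fun x => φ x • X x) U :=
  ContMDiffOn.smul_section hφ hX

lemma cov_congr_of_eqOn (cov : Connection E M) {X Y : VField E M} {U : Set M} (hU : IsOpen U)
    (hX : SmoothFieldOn X U) (hY : SmoothFieldOn Y U) (h : EqOn X Y U) {x : M} (hx : x ∈ U) :
    cov X x = cov Y x :=
  cov.isCovariantDerivativeOnUniv.congr_of_eventuallyEq (hX.mdifferentiableAt hU hx)
    (hY.mdifferentiableAt hU hx) univ_mem (h.eventuallyEq_of_mem (hU.mem_nhds hx))

/-- A smooth connection is smooth on locally defined fields. -/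
lemma contMDiffOn_cov [FiniteDimensional ℝ E] [T2Space M] {cov : Connection E M}
    (hcov : cov.ContMDiffCovariantDerivative ∞) {Y : VField E M} {U : Set M} (hU : IsOpen U)
    (hY : SmoothFieldOn Y U) :
    ContMDiffOn 𝓘(ℝ, E) (𝓘(ℝ, E).prod 𝓘(ℝ, E →L[ℝ] E)) ∞
      (fun x => (⟨x, cov Y x⟩ : TotalSpace (E →L[ℝ] E)
        fun x : M => TangentSpace 𝓘(ℝ, E) x →L[ℝ] TangentSpace 𝓘(ℝ, E) x)) U := by
  intro x hx
  -- Smoothness of the connection concerns global fields, so `Y` is multiplied by a bump function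
  -- supported in `U`. The product agrees with `Y` near `x`, and the connection is local.
  obtain ⟨ψ, hψ, -⟩ := (SmoothBumpFunction.nhds_basis_support (I := 𝓘(ℝ, E))
    (hU.mem_nhds hx)).mem_iff.1 (hU.mem_nhds hx)
  have hs : SmoothFieldOn ((ψ : M → ℝ) • Y) univ :=
    (ContMDiffOn.smul_section_of_tsupport (ψ.contMDiff).contMDiffOn hU hψ hY).contMDiffOn
  have h1 := hcov.contMDiff.contMDiff (σ := (ψ : M → ℝ) • Y) (by
    rw [show (∞ : WithTop ℕ∞) + 1 = ∞ from rfl]; exact hs)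
  have h2 := h1.contMDiffAt (x := x) univ_mem
  refine (h2.congr_of_eventuallyEq ?_).contMDiffWithinAt
  obtain ⟨V, hV, hVo, hxV⟩ := eventually_nhds_iff.1 (ψ.eventuallyEq_one)
  filter_upwards [(hVo.inter hU).mem_nhds ⟨hxV, hx⟩] with y hy
  have e := cov_congr_of_eqOn cov (hVo.inter hU) (hY.mono inter_subset_right)
    (hs.mono (subset_univ _)) (fun z hz => by
      change Y z = ψ z • Y z
      rw [hV z hz.1]
      exact (one_smul ℝ (Y z)).symm) hy
  exact congrArg (TotalSpace.mk y) e

lemma SmoothFieldOn.cov [FiniteDimensional ℝ E] [T2Space M] {cov : Connection E M}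
    (hcov : cov.ContMDiffCovariantDerivative ∞) {X Y : VField E M} {U : Set M} (hU : IsOpen U)
    (hX : SmoothFieldOn X U) (hY : SmoothFieldOn Y U) :
    SmoothFieldOn (fun x => cov Y x (X x)) U :=
  (contMDiffOn_cov hcov hU hY).clm_bundle_apply hX

variable [FiniteDimensional ℝ E]

omit [FiniteDimensional ℝ E] in
lemma contMDiffOn_inner (g : Metric E M) {X Y : VField E M} {U : Set M} (hX : SmoothFieldOn X U)
    (hY : SmoothFieldOn Y U) :
    ContMDiffOn 𝓘(ℝ, E) 𝓘(ℝ, ℝ) ∞ (fun x => g.inner x (X x) (Y x)) U := by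
  let _ : RiemannianBundle (fun x : M => TangentSpace 𝓘(ℝ, E) x) := ⟨g.toRiemannianMetric⟩
  exact ContMDiffOn.inner_bundle (IB := 𝓘(ℝ, E)) (F := E)
    (E := fun x : M => TangentSpace 𝓘(ℝ, E) x) hX hY

lemma IsLeviCivita.mlieBracket_eq {g : Metric E M} {cov : Connection E M}
    (h : IsLeviCivita g cov) {X Y : VField E M} {x : M}
    (hX : MDifferentiableAt 𝓘(ℝ, E) (𝓘(ℝ, E).prod 𝓘(ℝ, E))
      (fun y => (⟨y, X y⟩ : TangentBundle 𝓘(ℝ, E) M)) x)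
    (hY : MDifferentiableAt 𝓘(ℝ, E) (𝓘(ℝ, E).prod 𝓘(ℝ, E))
      (fun y => (⟨y, Y y⟩ : TangentBundle 𝓘(ℝ, E) M)) x) :
    VectorField.mlieBracket 𝓘(ℝ, E) X Y x = cov Y x (X x) - cov X x (Y x) :=
  ((CovariantDerivative.torsion_eq_zero_iff cov).1 h.torsion_free hX hY).symm

/-- The curvature operator of a metric connection is skew-symmetric. -/
lemma IsLeviCivita.inner_curvature_skew [T2Space M] {g : Metric E M} {cov : Connection E M}
    (h : IsLeviCivita g cov) {U : Set M} (hU : IsOpen U) {X Y Z W : VField E M}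
    (hX : SmoothFieldOn X U) (hY : SmoothFieldOn Y U) (hZ : SmoothFieldOn Z U)
    (hW : SmoothFieldOn W U) {x : M} (hx : x ∈ U) :
    g.inner x (curvature cov X Y Z x) (W x) + g.inner x (Z x) (curvature cov X Y W x) = 0 := by
  have hm : ∀ A B : VField E M, SmoothFieldOn A U → SmoothFieldOn B U → ∀ y ∈ U, ∀ v,
      mvfderiv 𝓘(ℝ, E) (fun y => g.inner y (A y) (B y)) y v
        = g.inner y (cov A y v) (B y) + g.inner y (A y) (cov B y v) := fun A B hA hB y hy =>
    h.metric A B y (hA.mdifferentiableAt hU hy) (hB.mdifferentiableAt hU hy)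
  -- Metric compatibility used twice. The mixed terms are symmetric in `A` and `B`, so they cancel
  -- in the commutator applied to ⟨Z, W⟩.
  have h2 : ∀ A B : VField E M, SmoothFieldOn A U → SmoothFieldOn B U →
      mvfderiv 𝓘(ℝ, E)
          (fun y => mvfderiv 𝓘(ℝ, E) (fun y => g.inner y (Z y) (W y)) y (B y)) x (A x)
        = g.inner x (cov (fun y => cov Z y (B y)) x (A x)) (W x)
          + g.inner x (cov Z x (B x)) (cov W x (A x))
          + (g.inner x (cov Z x (A x)) (cov W x (B x))
            + g.inner x (Z x) (cov (fun y => cov W y (B y)) x (A x))) := by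
    intro A B hA hB
    have hZB := SmoothFieldOn.cov h.smooth hU hB hZ
    have hWB := SmoothFieldOn.cov h.smooth hU hB hW
    rw [mvfderiv_congr_of_eqOn hU (fun y hy => hm Z W hZ hW y hy (B y)) hx]
    rw [mvfderiv_fun_add (mdifferentiableAt_of_contMDiffOn hU (contMDiffOn_inner g hZB hW) hx)
      (mdifferentiableAt_of_contMDiffOn hU (contMDiffOn_inner g hZ hWB) hx)]
    rw [_root_.add_apply, hm _ _ hZB hW x hx, hm _ _ hZ hWB x hx]
  have hb := mvfderiv_mlieBracket hU (contMDiffOn_inner g hZ hW) hX hY hx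
  rw [h2 X Y hX hY, h2 Y X hY hX, hm Z W hZ hW x hx] at hb
  simp only [curvature, map_sub, _root_.sub_apply]
  linarith

end Geometry

/-! ### Curvature tensor of a surface of constant curvature -/

section Curvature

open Set Filter Topology

variable {E : Type*} [NormedAddCommGroup E] [NormedSpace ℝ E] [FiniteDimensional ℝ E]
  {M : Type*} [TopologicalSpace M] [T2Space M] [ChartedSpace E M] [IsManifold 𝓘(ℝ, E) ∞ M]

omit [FiniteDimensional ℝ E] [T2Space M] in
lemma curvature_swap (cov : Connection E M) (X Y Z : VField E M) (x : M) :
    curvature cov X Y Z x = -curvature cov Y X Z x := by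
  rw [curvature, curvature, VectorField.mlieBracket_swap_apply, map_neg]
  abel

lemma mdifferentiableAt_cov_apply {cov : Connection E M}
    (hcov : cov.ContMDiffCovariantDerivative ∞) {U : Set M} (hU : IsOpen U) {X Z : VField E M}
    (hZ : SmoothFieldOn Z U) {x : M} (hx : x ∈ U)
    (hX : MDifferentiableAt 𝓘(ℝ, E) (𝓘(ℝ, E).prod 𝓘(ℝ, E))
      (fun y => (⟨y, X y⟩ : TangentBundle 𝓘(ℝ, E) M)) x) :
    MDifferentiableAt 𝓘(ℝ, E) (𝓘(ℝ, E).prod 𝓘(ℝ, E))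
      (fun y => (⟨y, cov Z y (X y)⟩ : TangentBundle 𝓘(ℝ, E) M)) x :=
  (((contMDiffOn_cov hcov hU hZ).contMDiffAt (hU.mem_nhds hx)).mdifferentiableAt
    (by simp)).clm_bundle_apply hX

/-- The curvature is function linear in its first argument. -/
lemma tensorialAt_curvature {cov : Connection E M}
    (hcov : cov.ContMDiffCovariantDerivative ∞) {U : Set M} (hU : IsOpen U) {Y Z : VField E M}
    (hZ : SmoothFieldOn Z U) {x : M} (hx : x ∈ U) :
    TensorialAt 𝓘(ℝ, E) E (fun X : VField E M => curvature cov X Y Z x) x where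
  smul {f X} hf hX := by
    have h2 : cov (fun y => cov Z y ((f • X) y)) x
        = f x • cov (fun y => cov Z y (X y)) x
          + (mvfderiv 𝓘(ℝ, E) f x).smulRight (cov Z x (X x)) := by
      rw [← cov.isCovariantDerivativeOnUniv.leibniz
        (mdifferentiableAt_cov_apply hcov hU hZ hx hX) hf]
      congr 1
      funext y
      exact (cov Z y).map_smul (f y) (X y)
    have h1 : (f • X) x = f x • X x := rfl
    have : IsManifold 𝓘(ℝ, E) 2 M := IsManifold.of_le (n := ∞) (by norm_cast)
    -- [fX, Y] contributes -(Yf)X, which cancels the derivative of f arising from ∇_Y(f ∇_X Z).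
    have h3 := VectorField.mlieBracket_smul_left (W := Y) hf hX
    simp only [curvature]
    rw [h2, h1, h3]
    simp only [map_add, map_smul, _root_.add_apply, ContinuousLinearMap.smulRight_apply,
      _root_.smul_apply]
    module
  add {X X'} hX hX' := by
    have h2 : cov (fun y => cov Z y ((X + X') y)) x
        = cov (fun y => cov Z y (X y)) x + cov (fun y => cov Z y (X' y)) x := by
      rw [← cov.isCovariantDerivativeOnUniv.add
        (mdifferentiableAt_cov_apply hcov hU hZ hx hX)
        (mdifferentiableAt_cov_apply hcov hU hZ hx hX')]
      congr 1
      funext y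
      exact (cov Z y).map_add (X y) (X' y)
    have h1 : (X + X') x = X x + X' x := rfl
    have : IsManifold 𝓘(ℝ, E) 2 M := IsManifold.of_le (n := ∞) (by norm_cast)
    have h3 := VectorField.mlieBracket_add_left (W := Y) hX hX'
    simp only [curvature]
    rw [h2, h1, h3]
    simp only [map_add, _root_.add_apply]
    abel

/-- The curvature vanishes on linearly dependent vectors. -/
lemma curvature_eq_zero_of_not_linearIndependent {cov : Connection E M}
    (hcov : cov.ContMDiffCovariantDerivative ∞) {U : Set M} (hU : IsOpen U) {X Y Z : VField E M}
    (hX : SmoothFieldOn X U) (hY : SmoothFieldOn Y U) (hZ : SmoothFieldOn Z U) {x : M}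
    (hx : x ∈ U) (hdep : ¬ LinearIndependent ℝ ![X x, Y x]) :
    curvature cov X Y Z x = 0 := by
  have hself : ∀ W : VField E M, curvature cov W W Z x = 0 := fun W => by
    simp [curvature]
  have hT := tensorialAt_curvature hcov hU (Y := Y) hZ hx
  by_cases hY0 : Y x = 0
  · have hT' := tensorialAt_curvature hcov hU (Y := X) hZ hx
    rw [curvature_swap, neg_eq_zero]
    refine (hT'.pointwise (hY.mdifferentiableAt hU hx)
      ((smoothFieldOn_zero U).mdifferentiableAt hU hx) hY0).trans hT'.zero
  · have : ∃ c : ℝ, X x = c • Y x := by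
      rw [LinearIndependent.pair_symm_iff, LinearIndependent.pair_iff' hY0] at hdep
      push Not at hdep
      obtain ⟨c, hc⟩ := hdep
      exact ⟨c, hc.symm⟩
    obtain ⟨c, hc⟩ := this
    have hYd := hY.mdifferentiableAt hU hx
    have hcd : MDifferentiableAt 𝓘(ℝ, E) 𝓘(ℝ, ℝ) (fun _ : M => c) x := mdifferentiableAt_const
    have h1 := hT.pointwise (σ' := (fun _ : M => c) • Y) (hX.mdifferentiableAt hU hx)
      (hcd.smul_section hYd) hc
    have h2 := hT.smul hcd hYd
    refine h1.trans (h2.trans ?_)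
    rw [hself, smul_zero]

-- In dimension two an independent pair spans, so `v - w`, orthogonal to both vectors, is orthogonal
-- to itself.
omit [FiniteDimensional ℝ E] [T2Space M] in
lemma eq_of_inner_eq
    (hdim : Module.finrank ℝ E = 2) (g : Metric E M) {x : M}
    {a b v w : TangentSpace 𝓘(ℝ, E) x} (hab : LinearIndependent ℝ ![a, b])
    (ha : g.inner x v a = g.inner x w a) (hb : g.inner x v b = g.inner x w b) : v = w := by
  rw [← sub_eq_zero]
  by_contra hne
  have hpos := g.pos x (v - w) hne
  have hspan : Submodule.span ℝ (range ![a, b]) = ⊤ :=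
    hab.span_eq_top_of_card_eq_finrank (by rw [Fintype.card_fin]; exact hdim.symm)
  have hmem : v - w ∈ Submodule.span ℝ (range ![a, b]) := hspan ▸ Submodule.mem_top
  rw [Matrix.range_cons, Matrix.range_cons, Matrix.range_empty, union_empty,
    singleton_union, Submodule.mem_span_pair] at hmem
  obtain ⟨s, t, hst⟩ := hmem
  have h0 : g.inner x (v - w) (s • a + t • b) = 0 := by
    simp only [map_add, map_smul, map_sub, _root_.sub_apply, ha, hb]
    simp
  rw [hst] at h0
  exact hpos.ne' h0

/-- The curvature of a surface of constant curvature. -/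
lemma curvature_eq_of_hasConstantCurvature (hdim : Module.finrank ℝ E = 2) {g : Metric E M}
    {cov : Connection E M} (hcov : IsLeviCivita g cov) {K : ℝ}
    (hK : HasConstantCurvature g cov K) {U : Set M} (hU : IsOpen U) {X Y Z : VField E M}
    (hX : SmoothFieldOn X U) (hY : SmoothFieldOn Y U) (hZ : SmoothFieldOn Z U) {x : M}
    (hx : x ∈ U) :
    curvature cov X Y Z x
      = K • (g.inner x (Y x) (Z x) • X x - g.inner x (X x) (Z x) • Y x) := by
  by_cases hind : LinearIndependent ℝ ![X x, Y x]
  · have hgram : g.inner x (X x) (X x) * g.inner x (Y x) (Y x) - g.inner x (X x) (Y x) ^ 2 ≠ 0 := by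
      intro h0
      -- If the Gram determinant vanished, this combination would be orthogonal to both `X x` and `Y
      -- x`, contradicting independence.
      have hv : g.inner x (Y x) (Y x) • X x + (-g.inner x (X x) (Y x)) • Y x = 0 := by
        refine eq_of_inner_eq hdim g hind ?_ ?_
        · simp only [map_add, map_smul, map_zero, _root_.add_apply, _root_.smul_apply,
            _root_.zero_apply, smul_eq_mul, g.symm x (Y x) (X x)]
          linarith
        · simp only [map_add, map_smul, map_zero, _root_.add_apply, _root_.smul_apply,
            _root_.zero_apply, smul_eq_mul]
          ring
      have hY0 : Y x ≠ 0 := by simpa using hind.ne_zero 1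
      exact (g.pos x (Y x) hY0).ne' (LinearIndependent.pair_iff.1 hind _ _ hv).1
    have hs := hK U hU X Y hX hY x hx hind
    rw [sectionalCurvature, div_eq_iff hgram] at hs
    have skew : ∀ A B : VField E M, SmoothFieldOn A U → SmoothFieldOn B U →
        g.inner x (curvature cov X Y A x) (B x) = -g.inner x (curvature cov X Y B x) (A x) :=
      fun A B hA hB => by
        have := hcov.inner_curvature_skew hU hX hY hA hB hx
        rw [g.symm x (A x)] at this
        linarith
    have hYY : g.inner x (curvature cov X Y Y x) (Y x) = 0 := by
      have := skew Y Y hY hY; linarith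
    have hXX : g.inner x (curvature cov X Y X x) (X x) = 0 := by
      have := skew X X hX hX; linarith
    have hXY : g.inner x (X x) (Y x) = g.inner x (Y x) (X x) := g.symm x _ _
    have hRY : curvature cov X Y Y x
        = K • (g.inner x (Y x) (Y x) • X x - g.inner x (X x) (Y x) • Y x) := by
      refine eq_of_inner_eq hdim g hind ?_ ?_
      · rw [hs]
        simp only [map_smul, map_sub, _root_.sub_apply, _root_.smul_apply, smul_eq_mul, hXY]
        ring
      · rw [hYY]
        simp only [map_smul, map_sub, _root_.sub_apply, _root_.smul_apply, smul_eq_mul, hXY]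
        ring
    have hRX : curvature cov X Y X x
        = K • (g.inner x (Y x) (X x) • X x - g.inner x (X x) (X x) • Y x) := by
      refine eq_of_inner_eq hdim g hind ?_ ?_
      · rw [hXX]
        simp only [map_smul, map_sub, _root_.sub_apply, _root_.smul_apply, smul_eq_mul]
        ring
      · rw [skew X Y hX hY, hs]
        simp only [map_smul, map_sub, _root_.sub_apply, _root_.smul_apply, smul_eq_mul, hXY]
        ring
    -- Skewness moves the operator from `Z` onto `X` and `Y`, where it is known, so no expansion of
    -- `Z` in the frame is needed.
    refine eq_of_inner_eq hdim g hind ?_ ?_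
    · rw [skew Z X hZ hX, hRX]
      simp only [map_smul, map_sub, _root_.sub_apply, _root_.smul_apply, smul_eq_mul]
      ring
    · rw [skew Z Y hZ hY, hRY]
      simp only [map_smul, map_sub, _root_.sub_apply, _root_.smul_apply, smul_eq_mul, hXY]
      ring
  -- The curvature hypothesis is silent on dependent vectors; there both sides vanish by
  -- alternation.
  · rw [curvature_eq_zero_of_not_linearIndependent hcov.smooth hU hX hY hZ hx hind]
    refine Eq.symm ?_
    by_cases hY0 : Y x = 0
    · simp [hY0]
    · rw [LinearIndependent.pair_symm_iff, LinearIndependent.pair_iff' hY0] at hind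
      push Not at hind
      obtain ⟨c, hc⟩ := hind
      rw [← hc]
      simp only [map_smul, _root_.smul_apply, smul_eq_mul]
      module

end Curvature

/-! ### Groups of smooth functions and fields on U -/

section Restricted

open Set Filter Topology

open scoped Classical in
/-- The restriction of a field to a set, extended by zero. -/
def cutField {E : Type*} [NormedAddCommGroup E] [NormedSpace ℝ E] {M : Type*} [TopologicalSpace M]
    [ChartedSpace E M] (U : Set M) (X : VField E M) : VField E M :=
  fun x => if x ∈ U then X x else 0

variable {E : Type*} [NormedAddCommGroup E] [NormedSpace ℝ E]
  {M : Type*} [TopologicalSpace M] [ChartedSpace E M]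

lemma cutField_of_mem {U : Set M} (X : VField E M) {x : M} (hx : x ∈ U) :
    cutField U X x = X x := if_pos hx

lemma cutField_of_notMem {U : Set M} (X : VField E M) {x : M} (hx : x ∉ U) :
    cutField U X x = 0 := if_neg hx

variable (E) in
/-- The smooth complex functions on `U`, extended by zero. -/
def smoothFunctions (U : Set M) : AddSubgroup (M → ℂ) where
  carrier := {φ | ContMDiffOn 𝓘(ℝ, E) 𝓘(ℝ, ℂ) ∞ φ U ∧ ∀ x ∉ U, φ x = 0}
  add_mem' h h' := ⟨h.1.add h'.1, fun x hx => by simp [h.2 x hx, h'.2 x hx]⟩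
  zero_mem' := ⟨contMDiffOn_const, fun _ _ => rfl⟩
  neg_mem' h := ⟨h.1.neg, fun x hx => by simp [h.2 x hx]⟩

/-- Extension by zero makes equality in the group the same as equality on `U`. -/
lemma smoothFunctions_ext {U : Set M} {φ ψ : smoothFunctions E U}
    (h : ∀ x ∈ U, φ.1 x = ψ.1 x) : φ = ψ := by
  refine Subtype.ext (funext fun x => ?_)
  by_cases hx : x ∈ U
  · exact h x hx
  · rw [φ.2.2 x hx, ψ.2.2 x hx]

/-- A smooth function on `U` as an element of `smoothFunctions`. -/
def mkFunction {U : Set M} {φ : M → ℂ} (hφ : ContMDiffOn 𝓘(ℝ, E) 𝓘(ℝ, ℂ) ∞ φ U) :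
    smoothFunctions E U :=
  ⟨U.indicator φ, hφ.congr fun _ hx => indicator_of_mem hx _,
    fun _ hx => indicator_of_notMem hx _⟩

lemma mkFunction_apply {U : Set M} {φ : M → ℂ} (hφ : ContMDiffOn 𝓘(ℝ, E) 𝓘(ℝ, ℂ) ∞ φ U) {x : M}
    (hx : x ∈ U) : (mkFunction hφ).1 x = φ x := indicator_of_mem hx _

/-- Multiplication of functions by the imaginary unit. -/
def mulI (U : Set M) : smoothFunctions E U →+ smoothFunctions E U :=
  AddMonoidHom.mk' (fun φ => ⟨fun x => Complex.I * φ.1 x,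
      ((ContinuousLinearMap.mul ℝ ℂ) Complex.I).contMDiff.comp_contMDiffOn φ.2.1,
      fun x hx => by simp only [φ.2.2 x hx, mul_zero]⟩)
    (fun φ ψ => Subtype.ext (funext fun x => mul_add _ _ _))

lemma mulI_apply {U : Set M} (φ : smoothFunctions E U) (x : M) :
    (mulI U φ).1 x = Complex.I * φ.1 x := rfl

lemma mulI_mulI {U : Set M} (φ : smoothFunctions E U) : mulI U (mulI U φ) = -φ := by
  refine Subtype.ext (funext fun x => ?_)
  rw [mulI_apply, mulI_apply, ← mul_assoc, Complex.I_mul_I, neg_one_mul]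
  rfl

variable [IsManifold 𝓘(ℝ, E) ∞ M]

variable (E) in
/-- The smooth vector fields on `U`, extended by zero. -/
def smoothFields (U : Set M) : AddSubgroup (VField E M) where
  carrier := {X | SmoothFieldOn X U ∧ ∀ x ∉ U, X x = 0}
  add_mem' {X Y} h h' := ⟨h.1.add h'.1, fun x hx => by
    change X x + Y x = 0
    rw [h.2 x hx, h'.2 x hx, add_zero]⟩
  zero_mem' := ⟨smoothFieldOn_zero U, fun _ _ => rfl⟩
  neg_mem' {X} h := ⟨h.1.neg, fun x hx => by
    change -X x = 0
    rw [h.2 x hx, neg_zero]⟩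

lemma smoothFields_ext {U : Set M} {X Y : smoothFields E U}
    (h : ∀ x ∈ U, X.1 x = Y.1 x) : X = Y := by
  refine Subtype.ext (funext fun x => ?_)
  by_cases hx : x ∈ U
  · exact h x hx
  · rw [X.2.2 x hx, Y.2.2 x hx]

/-- A smooth field on `U` as an element of `smoothFields`. -/
def mkField {U : Set M} {X : VField E M} (hX : SmoothFieldOn X U) : smoothFields E U :=
  ⟨cutField U X, hX.congr fun _ hx => cutField_of_mem X hx, fun _ hx => cutField_of_notMem X hx⟩

lemma mkField_apply {U : Set M} {X : VField E M} (hX : SmoothFieldOn X U) {x : M} (hx : x ∈ U) :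
    (mkField hX).1 x = X x := cutField_of_mem X hx

/-- The derivative of a function along a field. -/
def derivFun {U : Set M} (hU : IsOpen U) (X : smoothFields E U) (φ : smoothFunctions E U) :
    smoothFunctions E U :=
  mkFunction (contMDiffOn_mvfderiv_apply hU φ.2.1 X.2.1)

lemma derivFun_apply {U : Set M} (hU : IsOpen U) (X : smoothFields E U) (φ : smoothFunctions E U)
    {x : M} (hx : x ∈ U) : (derivFun hU X φ).1 x = mvfderiv 𝓘(ℝ, E) φ.1 x (X.1 x) :=
  mkFunction_apply (contMDiffOn_mvfderiv_apply hU φ.2.1 X.2.1) hx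

/-- The derivative of functions along fields. -/
def derivHom {U : Set M} (hU : IsOpen U) :
    smoothFields E U →+ smoothFunctions E U →+ smoothFunctions E U :=
  AddMonoidHom.mk' (fun X => AddMonoidHom.mk' (derivFun hU X)
    (fun φ ψ => smoothFunctions_ext fun x hx => by
      change _ = (derivFun hU X φ).1 x + (derivFun hU X ψ).1 x
      rw [derivFun_apply hU _ _ hx, derivFun_apply hU _ _ hx, derivFun_apply hU _ _ hx]
      change mvfderiv 𝓘(ℝ, E) (φ.1 + ψ.1) x (X.1 x) = _
      rw [mvfderiv_add (mdifferentiableAt_of_contMDiffOn hU φ.2.1 hx)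
        (mdifferentiableAt_of_contMDiffOn hU ψ.2.1 hx), _root_.add_apply]))
    (fun X Y => by
      refine AddMonoidHom.ext fun φ => smoothFunctions_ext fun x hx => ?_
      change (derivFun hU (X + Y) φ).1 x = (derivFun hU X φ).1 x + (derivFun hU Y φ).1 x
      rw [derivFun_apply hU _ _ hx, derivFun_apply hU _ _ hx, derivFun_apply hU _ _ hx]
      exact map_add _ (X.1 x) (Y.1 x))

lemma derivHom_apply {U : Set M} (hU : IsOpen U) (X : smoothFields E U) (φ : smoothFunctions E U)
    {x : M} (hx : x ∈ U) : (derivHom hU X φ).1 x = mvfderiv 𝓘(ℝ, E) φ.1 x (X.1 x) :=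
  derivFun_apply hU X φ hx

lemma derivHom_mulI {U : Set M} (hU : IsOpen U) (X : smoothFields E U)
    (φ : smoothFunctions E U) : derivHom hU X (mulI U φ) = mulI U (derivHom hU X φ) := by
  refine smoothFunctions_ext fun x hx => ?_
  rw [mulI_apply, derivHom_apply hU _ _ hx, derivHom_apply hU _ _ hx]
  have h := mdifferentiableAt_of_contMDiffOn hU φ.2.1 hx
  have hc : HasMFDerivAt 𝓘(ℝ, E) 𝓘(ℝ, ℂ) (fun y => Complex.I * φ.1 y) x
      (((ContinuousLinearMap.mul ℝ ℂ) Complex.I).comp (mfderiv 𝓘(ℝ, E) 𝓘(ℝ, ℂ) φ.1 x)) :=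
    ((ContinuousLinearMap.mul ℝ ℂ) Complex.I).hasMFDerivAt.comp x h.hasMFDerivAt
  exact DFunLike.congr_fun hc.mfderiv (X.1 x)

variable [FiniteDimensional ℝ E] [T2Space M]

/-- The covariant derivative `∇_X Y`. -/
def covField {cov : Connection E M} (hcov : cov.ContMDiffCovariantDerivative ∞) {U : Set M}
    (hU : IsOpen U) (X Y : smoothFields E U) : smoothFields E U :=
  mkField (SmoothFieldOn.cov hcov hU X.2.1 Y.2.1)

lemma covField_apply {cov : Connection E M} (hcov : cov.ContMDiffCovariantDerivative ∞)
    {U : Set M} (hU : IsOpen U) (X Y : smoothFields E U) {x : M} (hx : x ∈ U) :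
    (covField hcov hU X Y).1 x = cov Y.1 x (X.1 x) :=
  mkField_apply (SmoothFieldOn.cov hcov hU X.2.1 Y.2.1) hx

/-- The covariant derivative `∇_X Y` as a biadditive map. -/
def covHom {cov : Connection E M} (hcov : cov.ContMDiffCovariantDerivative ∞) {U : Set M}
    (hU : IsOpen U) : smoothFields E U →+ smoothFields E U →+ smoothFields E U :=
  AddMonoidHom.mk' (fun X => AddMonoidHom.mk' (covField hcov hU X)
    (fun Y Y' => smoothFields_ext fun x hx => by
      change _ = (covField hcov hU X Y).1 x + (covField hcov hU X Y').1 x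
      rw [covField_apply hcov hU _ _ hx, covField_apply hcov hU _ _ hx,
        covField_apply hcov hU _ _ hx]
      change cov (Y.1 + Y'.1) x (X.1 x) = _
      rw [cov.isCovariantDerivativeOnUniv.add (Y.2.1.mdifferentiableAt hU hx)
        (Y'.2.1.mdifferentiableAt hU hx), _root_.add_apply]))
    (fun X X' => by
      refine AddMonoidHom.ext fun Y => smoothFields_ext fun x hx => ?_
      change (covField hcov hU (X + X') Y).1 x
        = (covField hcov hU X Y).1 x + (covField hcov hU X' Y).1 x
      rw [covField_apply hcov hU _ _ hx, covField_apply hcov hU _ _ hx,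
        covField_apply hcov hU _ _ hx]
      exact map_add _ (X.1 x) (X'.1 x))

lemma covHom_apply {cov : Connection E M} (hcov : cov.ContMDiffCovariantDerivative ∞) {U : Set M}
    (hU : IsOpen U) (X Y : smoothFields E U) {x : M} (hx : x ∈ U) :
    (covHom hcov hU X Y).1 x = cov Y.1 x (X.1 x) :=
  covField_apply hcov hU X Y hx

/-- The commutator of derivatives is the derivative along the Lie bracket, which vanishing torsion
expresses through the connection. This is the hypothesis `hD` of the algebra. -/
lemma IsLeviCivita.derivHom_bracket {g : Metric E M} {cov : Connection E M}
    (h : IsLeviCivita g cov) {U : Set M} (hU : IsOpen U) (X Y : smoothFields E U)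
    (φ : smoothFunctions E U) :
    derivHom hU X (derivHom hU Y φ) - derivHom hU Y (derivHom hU X φ)
      = derivHom hU (covHom h.smooth hU X Y - covHom h.smooth hU Y X) φ := by
  refine smoothFunctions_ext fun x hx => ?_
  change (derivHom hU X (derivHom hU Y φ)).1 x - (derivHom hU Y (derivHom hU X φ)).1 x = _
  rw [derivHom_apply hU _ _ hx, derivHom_apply hU _ _ hx, derivHom_apply hU _ _ hx,
    mvfderiv_congr_of_eqOn hU (fun y hy => derivHom_apply hU Y φ hy) hx,
    mvfderiv_congr_of_eqOn hU (fun y hy => derivHom_apply hU X φ hy) hx,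
    ← mvfderiv_mlieBracket hU φ.2.1 X.2.1 Y.2.1 hx,
    h.mlieBracket_eq (X.2.1.mdifferentiableAt hU hx) (Y.2.1.mdifferentiableAt hU hx)]
  change _ = mvfderiv 𝓘(ℝ, E) φ.1 x
    ((covHom h.smooth hU X Y).1 x - (covHom h.smooth hU Y X).1 x)
  rw [covHom_apply h.smooth hU _ _ hx, covHom_apply h.smooth hU _ _ hx]

lemma IsLeviCivita.curv_covHom_apply {g : Metric E M} {cov : Connection E M}
    (h : IsLeviCivita g cov) {U : Set M} (hU : IsOpen U) (A B C : smoothFields E U) {x : M}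
    (hx : x ∈ U) : (curv (covHom h.smooth hU) A B C).1 x = curvature cov A.1 B.1 C.1 x := by
  have h2 : ∀ A B : smoothFields E U,
      (covHom h.smooth hU A (covHom h.smooth hU B C)).1 x
        = cov (fun y => cov C.1 y (B.1 y)) x (A.1 x) := fun A B => by
    rw [covHom_apply h.smooth hU _ _ hx, cov_congr_of_eqOn cov hU (covHom h.smooth hU B C).2.1
      (SmoothFieldOn.cov h.smooth hU B.2.1 C.2.1)
      (fun y hy => covHom_apply h.smooth hU B C hy) hx]
  change (covHom h.smooth hU A (covHom h.smooth hU B C)).1 x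
    - (covHom h.smooth hU B (covHom h.smooth hU A C)).1 x
    - (covHom h.smooth hU (covHom h.smooth hU A B - covHom h.smooth hU B A) C).1 x = _
  rw [h2, h2, covHom_apply h.smooth hU _ _ hx, curvature,
    h.mlieBracket_eq (A.2.1.mdifferentiableAt hU hx) (B.2.1.mdifferentiableAt hU hx),
    ← covHom_apply h.smooth hU A B hx, ← covHom_apply h.smooth hU B A hx]
  rfl

/-- The curvature of a surface of constant curvature is parallel. -/
lemma covHom_curv (hdim : Module.finrank ℝ E = 2) {g : Metric E M}
    {cov : Connection E M} (h : IsLeviCivita g cov) {K : ℝ}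
    (hK : HasConstantCurvature g cov K) {U : Set M} (hU : IsOpen U) (X A B C : smoothFields E U) :
    covHom h.smooth hU X (curv (covHom h.smooth hU) A B C)
      = curv (covHom h.smooth hU) (covHom h.smooth hU X A) B C
        + curv (covHom h.smooth hU) A (covHom h.smooth hU X B) C
        + curv (covHom h.smooth hU) A B (covHom h.smooth hU X C) := by
  have hR : ∀ A B C : smoothFields E U, ∀ y ∈ U, (curv (covHom h.smooth hU) A B C).1 y
      = K • (g.inner y (B.1 y) (C.1 y) • A.1 y - g.inner y (A.1 y) (C.1 y) • B.1 y) :=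
    fun A B C y hy => by
      rw [h.curv_covHom_apply hU A B C hy]
      exact curvature_eq_of_hasConstantCurvature hdim h hK hU A.2.1 B.2.1 C.2.1 hy
  refine smoothFields_ext fun x hx => ?_
  change _ = (curv (covHom h.smooth hU) (covHom h.smooth hU X A) B C).1 x
    + (curv (covHom h.smooth hU) A (covHom h.smooth hU X B) C).1 x
    + (curv (covHom h.smooth hU) A B (covHom h.smooth hU X C)).1 x
  rw [hR _ _ _ x hx, hR _ _ _ x hx, hR _ _ _ x hx]
  simp only [covHom_apply h.smooth hU _ _ hx]
  have hin : ∀ P Q : smoothFields E U,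
      ContMDiffOn 𝓘(ℝ, E) 𝓘(ℝ, ℝ) ∞ (fun y => g.inner y (P.1 y) (Q.1 y)) U := fun P Q =>
    contMDiffOn_inner g P.2.1 Q.2.1
  have hm : ∀ P Q : smoothFields E U,
      mvfderiv 𝓘(ℝ, E) (fun y => g.inner y (P.1 y) (Q.1 y)) x (X.1 x)
        = g.inner x (cov P.1 x (X.1 x)) (Q.1 x) + g.inner x (P.1 x) (cov Q.1 x (X.1 x)) :=
    fun P Q => h.metric P.1 Q.1 x (P.2.1.mdifferentiableAt hU hx) (Q.2.1.mdifferentiableAt hU hx) _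
  have hs : ∀ (P Q W : smoothFields E U), SmoothFieldOn
      ((fun y => g.inner y (P.1 y) (Q.1 y)) • W.1) U := fun P Q W =>
    SmoothFieldOn.smul (hin P Q) W.2.1
  have hl : ∀ P Q W : smoothFields E U,
      cov ((fun y => g.inner y (P.1 y) (Q.1 y)) • W.1) x (X.1 x)
        = g.inner x (P.1 x) (Q.1 x) • cov W.1 x (X.1 x)
          + (g.inner x (cov P.1 x (X.1 x)) (Q.1 x)
            + g.inner x (P.1 x) (cov Q.1 x (X.1 x))) • W.1 x := fun P Q W => by
    rw [cov.isCovariantDerivativeOnUniv.leibniz (W.2.1.mdifferentiableAt hU hx)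
      (mdifferentiableAt_of_contMDiffOn hU (hin P Q) hx), _root_.add_apply, _root_.smul_apply,
      ContinuousLinearMap.smulRight_apply, hm]
  have hc : ∀ (c : ℝ) {W : VField E M}, SmoothFieldOn W U → SmoothFieldOn (c • W) U :=
    fun c W hW => SmoothFieldOn.smul contMDiffOn_const hW
  -- The closed form of the curvature is differentiated by the Leibniz rule; its difference is
  -- written as a sum with coefficient -1 to fit the rules for sums and constant multiples.
  have hsum := (hs B C A).add (hc (-1) (hs A C B))
  rw [cov_congr_of_eqOn cov hU (curv (covHom h.smooth hU) A B C).2.1 (hc K hsum)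
    (fun y hy => by
      rw [hR A B C y hy]
      change _ = K • (g.inner y (B.1 y) (C.1 y) • A.1 y
        + (-1 : ℝ) • g.inner y (A.1 y) (C.1 y) • B.1 y)
      module) hx,
    cov.isCovariantDerivativeOnUniv.smul_const K (hsum.mdifferentiableAt hU hx),
    cov.isCovariantDerivativeOnUniv.add ((hs B C A).mdifferentiableAt hU hx)
      ((hc (-1) (hs A C B)).mdifferentiableAt hU hx),
    cov.isCovariantDerivativeOnUniv.smul_const (-1) ((hs A C B).mdifferentiableAt hU hx),
    _root_.smul_apply, _root_.add_apply, _root_.smul_apply, hl, hl]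
  module

end Restricted

/-! ### Comparison of complex fields with pairs of real fields -/

section Transfer

open Set Function

section ReIm

variable {E : Type*} [NormedAddCommGroup E] [NormedSpace ℝ E]
  {M : Type*} [TopologicalSpace M] [ChartedSpace E M]

lemma CField.re_mk (X Y : VField E M) : (CField.mk X Y).re = X := by
  funext x
  simp [CField.re, CField.mk]

lemma CField.im_mk (X Y : VField E M) : (CField.mk X Y).im = Y := by
  funext x
  simp [CField.im, CField.mk]

lemma CField.re_sub (Z W : CField E M) : (Z - W).re = Z.re - W.re := by
  funext x
  simp [CField.re]

lemma CField.im_sub (Z W : CField E M) : (Z - W).im = Z.im - W.im := by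
  funext x
  simp [CField.im]

lemma CField.re_neg (Z : CField E M) : (-Z).re = -Z.re := by
  funext x
  simp [CField.re]

lemma CField.im_neg (Z : CField E M) : (-Z).im = -Z.im := by
  funext x
  simp [CField.im]

end ReIm

variable {E : Type*} [NormedAddCommGroup E] [NormedSpace ℝ E]
  {M : Type*} [TopologicalSpace M] [ChartedSpace E M] [IsManifold 𝓘(ℝ, E) ∞ M]

/-- The complex field `Z` agrees on `U` with a given pair of real and imaginary parts. -/
def Represents (U : Set M) (Z : CField E M) (p : smoothFields E U × smoothFields E U) : Prop :=
  EqOn Z.re p.1.1 U ∧ EqOn Z.im p.2.1 U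

lemma represents_mkField {U : Set M} {Z : CField E M} (hZ : Z.SmoothOn U) :
    Represents U Z (mkField hZ.1, mkField hZ.2) :=
  ⟨fun _ hx => (mkField_apply hZ.1 hx).symm, fun _ hx => (mkField_apply hZ.2 hx).symm⟩

lemma Represents.sub {U : Set M} {Z W : CField E M} {p q : smoothFields E U × smoothFields E U}
    (hZ : Represents U Z p) (hW : Represents U W q) : Represents U (Z - W) (p - q) :=
  ⟨fun x hx => by
      rw [CField.re_sub]
      exact congrArg₂ (· - ·) (hZ.1 hx) (hW.1 hx),
    fun x hx => by
      rw [CField.im_sub]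
      exact congrArg₂ (· - ·) (hZ.2 hx) (hW.2 hx)⟩

lemma Represents.neg {U : Set M} {Z : CField E M} {p : smoothFields E U × smoothFields E U}
    (hZ : Represents U Z p) : Represents U (-Z) (-p) :=
  ⟨fun x hx => by
      rw [CField.re_neg]
      exact congrArg Neg.neg (hZ.1 hx),
    fun x hx => by
      rw [CField.im_neg]
      exact congrArg Neg.neg (hZ.2 hx)⟩

lemma Represents.update {U : Set M} {n : ℕ} {Z : Fin n → CField E M}
    {P : Fin n → smoothFields E U × smoothFields E U} (h : ∀ k, Represents U (Z k) (P k))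
    (j : Fin n) {W : CField E M} {q : smoothFields E U × smoothFields E U}
    (hW : Represents U W q) (k : Fin n) :
    Represents U (Function.update Z j W k) (Function.update P j q k) := by
  rcases eq_or_ne k j with rfl | hk
  · rwa [update_self, update_self]
  · rw [update_of_ne hk, update_of_ne hk]
    exact h k

variable [FiniteDimensional ℝ E] [T2Space M]

lemma Represents.nabla {cov : Connection E M} (hcov : cov.ContMDiffCovariantDerivative ∞)
    {U : Set M} (hU : IsOpen U) {Z W : CField E M} {p q : smoothFields E U × smoothFields E U}
    (hZ : Represents U Z p) (hW : Represents U W q) :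
    Represents U (nabla cov Z W) (complexify (covHom hcov hU) p q) := by
  have hc : ∀ (X Y : smoothFields E U) (A B : VField E M), EqOn A X.1 U → EqOn B Y.1 U →
      ∀ x ∈ U, cov B x (A x) = (covHom hcov hU X Y).1 x := fun X Y A B hA hB x hx => by
    rw [covHom_apply hcov hU X Y hx, hA hx,
      cov_congr_of_eqOn cov hU (Y.2.1.congr hB) Y.2.1 hB hx]
  refine ⟨fun x hx => ?_, fun x hx => ?_⟩
  · rw [CovHess.nabla, CField.re_mk, hc p.1 q.1 _ _ hZ.1 hW.1 x hx,
      hc p.2 q.2 _ _ hZ.2 hW.2 x hx]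
    rfl
  · rw [CovHess.nabla, CField.im_mk, hc p.1 q.2 _ _ hZ.1 hW.2 x hx,
      hc p.2 q.1 _ _ hZ.2 hW.1 x hx]
    rfl

/-- Vanishing torsion, applied to real and imaginary parts, turns the bracket into the form built
into `curv`. -/
lemma Represents.cBracket {g : Metric E M} {cov : Connection E M} (h : IsLeviCivita g cov)
    {U : Set M} (hU : IsOpen U) {Z W : CField E M} {p q : smoothFields E U × smoothFields E U}
    (hZ : Represents U Z p) (hW : Represents U W q) :
    Represents U (cBracket Z W)
      (complexify (covHom h.smooth hU) p q - complexify (covHom h.smooth hU) q p) := by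
  have hb : ∀ (X Y : smoothFields E U) (A B : VField E M), EqOn A X.1 U → EqOn B Y.1 U →
      ∀ x ∈ U, VectorField.mlieBracket 𝓘(ℝ, E) A B x
        = (covHom h.smooth hU X Y).1 x - (covHom h.smooth hU Y X).1 x :=
    fun X Y A B hA hB x hx => by
      have hA' := X.2.1.congr hA
      have hB' := Y.2.1.congr hB
      rw [h.mlieBracket_eq (hA'.mdifferentiableAt hU hx) (hB'.mdifferentiableAt hU hx),
        covHom_apply h.smooth hU X Y hx, covHom_apply h.smooth hU Y X hx, hA hx, hB hx,
        cov_congr_of_eqOn cov hU hB' Y.2.1 hB hx, cov_congr_of_eqOn cov hU hA' X.2.1 hA hx]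
  refine ⟨fun x hx => ?_, fun x hx => ?_⟩
  · rw [CovHess.cBracket, CField.re_mk, Pi.sub_apply, hb p.1 q.1 _ _ hZ.1 hW.1 x hx,
      hb p.2 q.2 _ _ hZ.2 hW.2 x hx]
    change _ = ((covHom h.smooth hU p.1 q.1).1 x - (covHom h.smooth hU p.2 q.2).1 x)
      - ((covHom h.smooth hU q.1 p.1).1 x - (covHom h.smooth hU q.2 p.2).1 x)
    abel
  · rw [CovHess.cBracket, CField.im_mk, Pi.add_apply, hb p.1 q.2 _ _ hZ.1 hW.2 x hx,
      hb p.2 q.1 _ _ hZ.2 hW.1 x hx]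
    change _ = ((covHom h.smooth hU p.1 q.2).1 x + (covHom h.smooth hU p.2 q.1).1 x)
      - ((covHom h.smooth hU q.1 p.2).1 x + (covHom h.smooth hU q.2 p.1).1 x)
    abel

lemma Represents.cCurvature {g : Metric E M} {cov : Connection E M} (h : IsLeviCivita g cov)
    {U : Set M} (hU : IsOpen U) {Z W V : CField E M}
    {p q r : smoothFields E U × smoothFields E U}
    (hZ : Represents U Z p) (hW : Represents U W q) (hV : Represents U V r) :
    Represents U (cCurvature cov Z W V) (curv (complexify (covHom h.smooth hU)) p q r) :=
  ((hZ.nabla h.smooth hU (hW.nabla h.smooth hU hV)).sub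
    (hW.nabla h.smooth hU (hZ.nabla h.smooth hU hV))).sub
    ((hZ.cBracket h hU hW).nabla h.smooth hU hV)

/-- Only values on the open set `U` enter the derivatives there, so arbitrary behaviour outside `U`
is harmless. The induction runs over all tuples, since each step replaces one argument by its
covariant derivative. -/
lemma iterNabla_eq_hess {cov : Connection E M} (hcov : cov.ContMDiffCovariantDerivative ∞)
    {U : Set M} (hU : IsOpen U) {f : M → ℂ} {φ : smoothFunctions E U} (hφ : EqOn f φ.1 U) :
    ∀ (n : ℕ) (Z : Fin n → CField E M) (P : Fin n → smoothFields E U × smoothFields E U),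
      (∀ k, Represents U (Z k) (P k)) →
        EqOn (iterNabla cov f n Z)
          (hess (complexifyDeriv (derivHom hU) (mulI U)) (complexify (covHom hcov hU)) φ n P).1 U
  | 0, _, _, _ => hφ
  | n + 1, Z, P, h => fun x hx => by
    have ih := iterNabla_eq_hess hcov hU hφ n
    have h0 := ih (fun k => Z k.succ) (Fin.tail P) fun k => h k.succ
    have hsum : ∑ j : Fin n, iterNabla cov f n
          (Function.update (fun k => Z k.succ) j (CovHess.nabla cov (Z 0) (Z j.succ))) x
        = (act (complexify (covHom hcov hU) (P 0))
            (hess (complexifyDeriv (derivHom hU) (mulI U)) (complexify (covHom hcov hU)) φ n)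
            (Fin.tail P)).1 x := by
      rw [act, AddSubgroup.val_finsetSum, Finset.sum_apply]
      exact Finset.sum_congr rfl fun j _ =>
        ih _ _ (Represents.update (fun k => h k.succ) j ((h 0).nabla hcov hU (h j.succ))) hx
    rw [iterNabla]
    beta_reduce
    rw [hsum, CField.deriv, mvfderiv_congr_of_eqOn hU h0 hx, (h 0).1 hx, (h 0).2 hx,
      ← derivHom_apply hU _ _ hx, ← derivHom_apply hU _ _ hx]
    rfl

end Transfer

end CovHess

end

theorem mainTheorem8
    {E : Type*} [NormedAddCommGroup E] [NormedSpace ℝ E] [FiniteDimensional ℝ E]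
    (hdim : Module.finrank ℝ E = 2)
    {M : Type*} [TopologicalSpace M] [T2Space M] [ChartedSpace E M] [IsManifold 𝓘(ℝ, E) ∞ M]
    (g : CovHess.Metric E M) (cov : CovHess.Connection E M) (hcov : CovHess.IsLeviCivita g cov)
    (K : ℝ) (hK : CovHess.HasConstantCurvature g cov K)
    (U : Set M) (hU : IsOpen U)
    (f : M → ℂ) (hf : ContMDiffOn 𝓘(ℝ, E) 𝓘(ℝ, ℂ) ∞ f U)
    (n : ℕ) (hn : 3 ≤ n + 2)
    (Z : Fin (n + 2) → CovHess.CField E M) (hZ : ∀ k, (Z k).SmoothOn U)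
    (x : M) (hx : x ∈ U) :
    CovHess.iterNabla cov f (n + 2) Z x
        - CovHess.iterNabla cov f (n + 2)
            (Z ∘ Equiv.swap (Fin.last n).castSucc (Fin.last (n + 1))) x = 0 ∧
    ∀ i : Fin n,
      CovHess.iterNabla cov f (n + 2) Z x
          - CovHess.iterNabla cov f (n + 2)
              (Z ∘ Equiv.swap i.castSucc.castSucc i.succ.castSucc) x
        = ∑ j ∈ Finset.Ici i,
            CovHess.iterNabla cov f n
              (Function.update (CovHess.removeTwo Z i) j
                (-CovHess.cCurvature cov (Z i.castSucc.castSucc) (Z i.succ.castSucc)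
                    (Z j.succ.succ))) x := by
  have hD := CovHess.complexifyDeriv_bracket (CovHess.derivHom hU)
    (CovHess.covHom hcov.smooth hU) (J := CovHess.mulI U) CovHess.mulI_mulI
    (CovHess.derivHom_mulI hU) (hcov.derivHom_bracket hU)
  have hN := CovHess.parallel_complexify (CovHess.covHom hcov.smooth hU)
    (CovHess.covHom_curv hdim hcov hK hU)
  have hφ : Set.EqOn f (CovHess.mkFunction hf).1 U := fun y hy =>
    (CovHess.mkFunction_apply hf hy).symm
  have hrep := fun k => CovHess.represents_mkField (hZ k)
  set P := fun k => (CovHess.mkField (hZ k).1, CovHess.mkField (hZ k).2)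
  have hT := CovHess.iterNabla_eq_hess hcov.smooth hU hφ
  refine ⟨?_, fun i => ?_⟩
  · rw [hT _ Z P hrep hx, hT _ (Z ∘ _) (P ∘ Equiv.swap (Fin.last n).castSucc (Fin.last (n + 1)))
      (fun k => hrep _) hx]
    exact congrFun (congrArg Subtype.val (CovHess.hess_swap_last _ _ hD _ n P)) x
  · rw [hT _ Z P hrep hx, hT _ (Z ∘ _) (P ∘ Equiv.swap i.castSucc.castSucc i.succ.castSucc)
      (fun k => hrep _) hx]
    refine (congrFun (congrArg Subtype.val (CovHess.hess_swap _ _ hD hN _ n i P)) x).trans ?_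
    rw [AddSubgroup.val_finsetSum, Finset.sum_apply]
    refine Finset.sum_congr rfl fun j hj => (hT _ _ _ ?_ hx).symm
    have hrem : CovHess.removeTwo Z i = Z ∘ CovHess.skipTwo i := by
      funext k
      rw [Function.comp_apply, CovHess.skipTwo_eq_ite, CovHess.removeTwo]
      split_ifs <;> rfl
    -- For `j ≥ i` the slot `j` left after the deletion holds the original argument `j + 2`.
    have hj' : CovHess.skipTwo i j = j.succ.succ := by
      rw [CovHess.skipTwo_eq_ite, if_neg (not_lt.2 (Finset.mem_Ici.1 hj))]
    rw [hrem, ← hj']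
    exact CovHess.Represents.update (fun k => hrep _) j
      (CovHess.Represents.cCurvature hcov hU (hrep _) (hrep _) (hrep _)).neg
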